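/- Let $G$ be an algebraic group over $\mathbb C$ (a smooth separated group scheme of finite type) acting algebraically on an irreducible algebraic manifold $M$ (a smooth, separated, integral scheme of finite type over $\mathbb C$; for instance a smooth irreducible quasi-projective variety), with function field $\mathbb C(M)$, and let $\mathfrak g$ be the Lie algebra of vector fields on $M$ given by the action of $G$. A $G$-equivariant line bundle on $M$ is an algebraic line bundle $L\to M$ with a lift of the action of $G$ to an algebraic action on $L$ that is linear on the fibres. A $\mathfrak g$-equivariant line bundle is an algebraic line bundle $L\to M$, with trivializations over an open cover $\{U_i\}$ and transition functions $g_{ij}$ (the fibre coordinates satisfy $u_i=g_{ij}u_j$), together with linear maps $\lambda_i\colon\mathfrak g\to\mathcal O(U_i)$ such that $\lambda_i([X,Y])=X(\lambda_i(Y))-Y(\lambda_i(X))$ and $\lambda_i(X)-\lambda_j(X)=X(g_{ij})/g_{ij}$; a rational section $R=\{R_i\}$ of it is invariant if $X(R_i)=\lambda_i(X)R_i$ for all $i$ and all $X\in\mathfrak g$. A rational (respectively polynomial) relative $G$-invariant is a non-zero invariant rational (respectively regular) section of a $G$-equivariant line bundle, and likewise for $\mathfrak g$. A rational absolute $G$-invariant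 is a function $I\in\mathbb C(M)$ that is constant on $G$-orbits; a rational absolute $\mathfrak g$-invariant is an $I\in\mathbb C(M)$ with $X(I)=0$ for all $X\in\mathfrak g$. 1. For every rational absolute $G$-invariant $I$ there are a $G$-equivariant line bundle $L$ and invariant regular sections $P,Q$ of $L$, with $Q\neq 0$, such that $I=P/Q$. (If $I\ne0$, then $P\neq0$, so $P$ and $Q$ are polynomial relative $G$-invariants of the same weight.) 2. Every rational relative $G$-invariant $R$ is a ratio of two polynomial relative $G$-invariants: if $R$ is a non-zero invariant rational section of a $G$-equivariant line bundle $L$, there are $G$-equivariant line bundles $L_P,L_Q$, non-zero invariant regular sections $P$ of $L_P$ and $Q$ of $L_Q$, and a $G$-equivariant isomorphism $L\otimes L_Q\cong L_P$ that maps $R\otimes Q$ to $P$. 3. and 4. The statements 1 and 2 also hold with $\mathfrak g$ in place of $G$ throughout. -/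

import Mathlib

open CategoryTheory AlgebraicGeometry MonoidalCategory CartesianMonoidalCategory MonObj

namespace RelInv

noncomputable section

/-- Schemes over the field of complex numbers. -/
abbrev CScheme : Type 1 := Over (Spec (CommRingCat.of ℂ))

/-- The pull-back `f^* s`, restricted to an open set `W` contained in the preimage of the
domain of `s`. -/
abbrev pull {X Y : Scheme.{0}} (f : X ⟶ Y) {V : Y.Opens} (s : Γ(Y, V)) (W : X.Opens)
    (h : W ≤ f ⁻¹ᵁ V) : Γ(X, W) :=
  (f.appLE V W h).hom s

/-- Restriction of a regular function to a smaller open set. -/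
abbrev res {X : Scheme.{0}} {V : X.Opens} (s : Γ(X, V)) (W : X.Opens) (h : W ≤ V) : Γ(X, W) :=
  (X.presheaf.map (homOfLE h).op).hom s

/-- A regular function on a non-empty open subset of an integral scheme, as a rational
function. -/
abbrev toRat {X : Scheme.{0}} [IsIntegral X] {U : X.Opens} [Nonempty U] (s : Γ(X, U)) :
    X.functionField :=
  (X.germToFunctionField U).hom s

/-! ### Line bundles and their rational sections -/

/-- A line bundle, given by a trivializing open cover and transition functions
`g i j ∈ 𝒪(U i ∩ U j)`; the fibre coordinates are related by `u i = g i j * u j`.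
(The functions `g i j` are nowhere zero since `g i j * g j i = g i i = 1`.) -/
structure LineBundle (X : Scheme.{0}) where
  idx : Type
  U : idx → X.Opens
  nonempty : ∀ i, Nonempty (U i)
  cover : ⨆ i, U i = ⊤
  g : ∀ i j, Γ(X, U i ⊓ U j)
  g_self : ∀ i, g i i = 1
  g_mul : ∀ i j k (W : X.Opens) (hij : W ≤ U i ⊓ U j) (hjk : W ≤ U j ⊓ U k)
    (hik : W ≤ U i ⊓ U k), res (g i j) W hij * res (g j k) W hjk = res (g i k) W hik

attribute [instance] LineBundle.nonempty

/-- A rational section of a line bundle: rational functions `R i` with `R i = g i j * R j`. -/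
structure RationalSection {X : Scheme.{0}} [IsIntegral X] (L : LineBundle X) where
  val : L.idx → X.functionField
  compat : ∀ i j (W : X.Opens) [Nonempty W] (h : W ≤ L.U i ⊓ L.U j),
    val i = toRat (res (L.g i j) W h) * val j

namespace RationalSection

variable {X : Scheme.{0}} [IsIntegral X] {L : LineBundle X}

/-- The section is regular (polynomial): `R i` is a regular function on `U i`. -/
def IsRegular (R : RationalSection L) : Prop :=
  ∀ i, ∃ s : Γ(X, L.U i), toRat s = R.val i

/-- The section is not the zero section. -/
def IsNonzero (R : RationalSection L) : Prop :=
  ∀ i, R.val i ≠ 0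

end RationalSection

/-- An isomorphism of line bundles `A ⊗ B ≅ C`, that is, a fibrewise non-zero bilinear map
from `A` and `B` to `C`. In fibre coordinates `u i`, `v j`, `w k` it reads
`w k = c i j k * u i * v j`. -/
structure TensorIso {X : Scheme.{0}} (A B C : LineBundle X) where
  c : ∀ i j k, Γ(X, A.U i ⊓ B.U j ⊓ C.U k)
  isUnit : ∀ i j k, IsUnit (c i j k)
  compat : ∀ i i' j j' k k' (W : X.Opens)
    (h : W ≤ A.U i ⊓ B.U j ⊓ C.U k) (h' : W ≤ A.U i' ⊓ B.U j' ⊓ C.U k')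
    (hA : W ≤ A.U i ⊓ A.U i') (hB : W ≤ B.U j ⊓ B.U j') (hC : W ≤ C.U k ⊓ C.U k'),
    res (c i j k) W h * res (A.g i i') W hA * res (B.g j j') W hB =
      res (C.g k k') W hC * res (c i' j' k') W h'

/-- The isomorphism `A ⊗ B ≅ C` maps the rational section `R ⊗ Q` to `P`. For non-zero `Q`
this says `R = P / Q`. -/
def TensorIso.MapsTo {X : Scheme.{0}} [IsIntegral X] {A B C : LineBundle X}
    (e : TensorIso A B C) (R : RationalSection A) (Q : RationalSection B)
    (P : RationalSection C) : Prop :=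
  ∀ i j k (W : X.Opens) [Nonempty W] (h : W ≤ A.U i ⊓ B.U j ⊓ C.U k),
    toRat (res (e.c i j k) W h) * R.val i * Q.val j = P.val k

/-! ### Actions of an algebraic group -/

section GroupAction

variable (G M : CScheme) [GrpObj G] [ModObj G M]

/-- The action morphism `(g, x) ↦ g x`. -/
def act : (G ⊗ M).left ⟶ M.left := (ModObj.smul (M := G) (X := M) : G ⊗ M ⟶ M).left

/-- The projection `(g, x) ↦ x`. -/
def proj : (G ⊗ M).left ⟶ M.left := (snd G M).left

/-- `x ↦ (1, x)`. -/
def oneMap : M.left ⟶ (G ⊗ M).left := ((λ_ M).inv ≫ η[G] ▷ M).left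

/-- `(g, h, x) ↦ (g h, x)`. -/
def mulMap : (G ⊗ G ⊗ M).left ⟶ (G ⊗ M).left := ((α_ G G M).inv ≫ μ[G] ▷ M).left

/-- `(g, h, x) ↦ (g, h x)`. -/
def actMap : (G ⊗ G ⊗ M).left ⟶ (G ⊗ M).left :=
  (G ◁ (ModObj.smul (M := G) (X := M) : G ⊗ M ⟶ M)).left

/-- `(g, h, x) ↦ (h, x)`. -/
def projMap : (G ⊗ G ⊗ M).left ⟶ (G ⊗ M).left := (snd G (G ⊗ M)).left

/-- A rational absolute invariant of `G`: a rational function `I` on `M` that is constant on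
orbits, `I (g x) = I x` whenever `I` is regular at `x` and at `g x`. -/
def IsAbsoluteInvariant [IsIntegral M.left] (I : M.left.functionField) : Prop :=
  ∀ (V : M.left.Opens) [Nonempty V] (f : Γ(M.left, V)), toRat f = I →
    ∀ (W : (G ⊗ M).left.Opens) (ha : W ≤ act G M ⁻¹ᵁ V) (hp : W ≤ proj G M ⁻¹ᵁ V),
      pull (act G M) f W ha = pull (proj G M) f W hp

/-- A lift of the action of `G` to a line bundle `L` over `M` by an algebraic action that is
linear on the fibres: `u i (g • l) = Φ i j (g, x) * u j l` for `l` in the fibre over `x`,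
`x ∈ U j`, `g x ∈ U i`. -/
structure Linearization (L : LineBundle M.left) where
  Φ : ∀ i j, Γ((G ⊗ M).left, act G M ⁻¹ᵁ L.U i ⊓ proj G M ⁻¹ᵁ L.U j)
  /-- Independence of the fibre coordinates. -/
  compat : ∀ i i' j j' (W : (G ⊗ M).left.Opens)
    (h : W ≤ act G M ⁻¹ᵁ L.U i ⊓ proj G M ⁻¹ᵁ L.U j)
    (h' : W ≤ act G M ⁻¹ᵁ L.U i' ⊓ proj G M ⁻¹ᵁ L.U j')
    (ha : W ≤ act G M ⁻¹ᵁ (L.U i ⊓ L.U i')) (hp : W ≤ proj G M ⁻¹ᵁ (L.U j ⊓ L.U j')),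
    res (Φ i j) W h * pull (proj G M) (L.g j j') W hp =
      pull (act G M) (L.g i i') W ha * res (Φ i' j') W h'
  /-- `1 • l = l`. -/
  one : ∀ i j (W : M.left.Opens) (h : W ≤ L.U i ⊓ L.U j)
    (h' : W ≤ oneMap G M ⁻¹ᵁ (act G M ⁻¹ᵁ L.U i ⊓ proj G M ⁻¹ᵁ L.U j)),
    pull (oneMap G M) (Φ i j) W h' = res (L.g i j) W h
  /-- `(g h) • l = g • (h • l)`. -/
  mul : ∀ i j k (W : (G ⊗ G ⊗ M).left.Opens)
    (hm : W ≤ mulMap G M ⁻¹ᵁ (act G M ⁻¹ᵁ L.U i ⊓ proj G M ⁻¹ᵁ L.U k))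
    (ha : W ≤ actMap G M ⁻¹ᵁ (act G M ⁻¹ᵁ L.U i ⊓ proj G M ⁻¹ᵁ L.U j))
    (hp : W ≤ projMap G M ⁻¹ᵁ (act G M ⁻¹ᵁ L.U j ⊓ proj G M ⁻¹ᵁ L.U k)),
    pull (mulMap G M) (Φ i k) W hm =
      pull (actMap G M) (Φ i j) W ha * pull (projMap G M) (Φ j k) W hp

variable {G M}

/-- The rational section `R` of the `G`-equivariant line bundle `(L, ρ)` is invariant:
`R i (g x) = Φ i j (g, x) * R j x` wherever both sides are regular. -/
def RationalSection.IsInvariant [IsIntegral M.left] {L : LineBundle M.left}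
    (R : RationalSection L) (ρ : Linearization G M L) : Prop :=
  ∀ i j (V V' : M.left.Opens) [Nonempty V] [Nonempty V'] (f : Γ(M.left, V))
    (f' : Γ(M.left, V')), toRat f = R.val i → toRat f' = R.val j →
    ∀ (W : (G ⊗ M).left.Opens) (ha : W ≤ act G M ⁻¹ᵁ V) (hp : W ≤ proj G M ⁻¹ᵁ V')
      (h : W ≤ act G M ⁻¹ᵁ L.U i ⊓ proj G M ⁻¹ᵁ L.U j),
      pull (act G M) f W ha = res (ρ.Φ i j) W h * pull (proj G M) f' W hp

/-- The isomorphism `A ⊗ B ≅ C` is `G`-equivariant. -/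
def TensorIso.IsEquivariant {A B C : LineBundle M.left} (e : TensorIso A B C)
    (ρA : Linearization G M A) (ρB : Linearization G M B) (ρC : Linearization G M C) : Prop :=
  ∀ i i' j j' k k' (W : (G ⊗ M).left.Opens)
    (ha : W ≤ act G M ⁻¹ᵁ (A.U i ⊓ B.U j ⊓ C.U k))
    (hp : W ≤ proj G M ⁻¹ᵁ (A.U i' ⊓ B.U j' ⊓ C.U k'))
    (hA : W ≤ act G M ⁻¹ᵁ A.U i ⊓ proj G M ⁻¹ᵁ A.U i')
    (hB : W ≤ act G M ⁻¹ᵁ B.U j ⊓ proj G M ⁻¹ᵁ B.U j')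
    (hC : W ≤ act G M ⁻¹ᵁ C.U k ⊓ proj G M ⁻¹ᵁ C.U k'),
    pull (act G M) (e.c i j k) W ha * res (ρA.Φ i i') W hA * res (ρB.Φ j j') W hB =
      res (ρC.Φ k k') W hC * pull (proj G M) (e.c i' j' k') W hp

end GroupAction

/-! ### The Lie algebra of the action -/

section LieAlgebraAction

/-- The function field of a complex variety is a `ℂ`-algebra. -/
instance functionFieldAlgebra (M : CScheme) [IsIntegral M.left] :
    Algebra ℂ M.left.functionField :=
  ((Scheme.ΓSpecIso (CommRingCat.of ℂ)).inv ≫ M.hom.appTop ≫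
    M.left.presheaf.germ ⊤ (genericPoint M.left) trivial).hom.toAlgebra

/-- The spectrum of the dual numbers `ℂ[ε]`. -/
abbrev dualSpec : CScheme :=
  Over.mk (Spec.map (CommRingCat.ofHom (algebraMap ℂ (DualNumber ℂ))))

/-- The function `ε` on the spectrum of the dual numbers. -/
def dualEps : Γ(dualSpec.left, ⊤) :=
  (Scheme.ΓSpecIso (CommRingCat.of (DualNumber ℂ))).inv.hom (DualNumber.eps : DualNumber ℂ)

/-- The tangent vector `v : Spec ℂ[ε] ⟶ G` is based at the unit element of `G`. -/
def IsTangentAtOne {G : CScheme} [GrpObj G] (v : dualSpec ⟶ G) : Prop :=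
  Spec.map (CommRingCat.ofHom (TrivSqZeroExt.fstHom ℂ ℂ ℂ).toRingHom) ≫ v.left = (η[G]).left

variable (G M : CScheme) [GrpObj G] [ModObj G M]

/-- `(ε, x) ↦ v(ε) x`. -/
def infAct {G : CScheme} (M : CScheme) [GrpObj G] [ModObj G M] (v : dualSpec ⟶ G) :
    (dualSpec ⊗ M).left ⟶ M.left :=
  (v ▷ M ≫ (ModObj.smul (M := G) (X := M) : G ⊗ M ⟶ M)).left

/-- `(ε, x) ↦ x`. -/
def infProj (M : CScheme) : (dualSpec ⊗ M).left ⟶ M.left := (snd dualSpec M).left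

/-- The function `ε` on `Spec ℂ[ε] × M`. -/
abbrev infEps (M : CScheme) (W : (dualSpec ⊗ M).left.Opens) : Γ((dualSpec ⊗ M).left, W) :=
  pull (fst dualSpec M).left dualEps W le_top

/-- The regular vector field `X` on `M`, viewed as a derivation of the function field, is the
fundamental vector field of a tangent vector `v` of `G` at the unit element:
`f (v(ε) x) = f x + ε * (X f) x` for every regular function `f`. -/
def IsFundamental [IsIntegral M.left]
    (X : Derivation ℂ M.left.functionField M.left.functionField) : Prop :=
  ∃ v : dualSpec ⟶ G, IsTangentAtOne v ∧
    ∀ (U : M.left.Opens) [Nonempty U] (f : Γ(M.left, U)), ∃ f' : Γ(M.left, U),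
      toRat f' = X (toRat f) ∧
      ∀ (W : (dualSpec ⊗ M).left.Opens) (ha : W ≤ infAct M v ⁻¹ᵁ U)
        (hp : W ≤ infProj M ⁻¹ᵁ U),
        pull (infAct M v) f W ha =
          pull (infProj M) f W hp + infEps M W * pull (infProj M) f' W hp

/-- The Lie algebra `𝔤` of vector fields on `M` given by the action of `G`. (The fundamental
vector fields form a Lie algebra already; taking the span makes this part of the type.) -/
def lieAlg [IsIntegral M.left] :
    LieSubalgebra ℂ (Derivation ℂ M.left.functionField M.left.functionField) :=
  LieSubalgebra.lieSpan ℂ _ {X | IsFundamental G M X}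

/-- A rational absolute invariant of `𝔤`: `X I = 0` for all `X ∈ 𝔤`. -/
def IsLieAbsoluteInvariant [IsIntegral M.left] (I : M.left.functionField) : Prop :=
  ∀ X : lieAlg G M, X.1 I = 0

/-- A lift of `𝔤` to a line bundle `L`, in fibre coordinates `X + lam i X * u i * ∂/∂(u i)`
with linear maps `lam i : 𝔤 → 𝒪(U i)`. -/
structure LieLinearization [IsIntegral M.left] (L : LineBundle M.left) where
  lam : L.idx → lieAlg G M →ₗ[ℂ] M.left.functionField
  regular : ∀ i X, ∃ s : Γ(M.left, L.U i), toRat s = lam i X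
  /-- The lift is a homomorphism of Lie algebras. -/
  cocycle : ∀ i (X Y : lieAlg G M), lam i ⁅X, Y⁆ = X.1 (lam i Y) - Y.1 (lam i X)
  /-- `lam i X - lam j X = X (g i j) / g i j`. -/
  compat : ∀ i j (X : lieAlg G M) (W : M.left.Opens) [Nonempty W] (h : W ≤ L.U i ⊓ L.U j),
    lam i X - lam j X = X.1 (toRat (res (L.g i j) W h)) / toRat (res (L.g i j) W h)

variable {G M}

/-- The rational section `R` of the `𝔤`-equivariant line bundle `(L, lam)` is invariant:
`X (R i) = lam i X * R i` for all `X ∈ 𝔤`. -/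
def RationalSection.IsLieInvariant [IsIntegral M.left] {L : LineBundle M.left}
    (R : RationalSection L) (ρ : LieLinearization G M L) : Prop :=
  ∀ i (X : lieAlg G M), X.1 (R.val i) = ρ.lam i X * R.val i

/-- The isomorphism `A ⊗ B ≅ C` is `𝔤`-equivariant. -/
def TensorIso.IsLieEquivariant [IsIntegral M.left] {A B C : LineBundle M.left}
    (e : TensorIso A B C) (ρA : LieLinearization G M A) (ρB : LieLinearization G M B)
    (ρC : LieLinearization G M C) : Prop :=
  ∀ i j k (X : lieAlg G M) (W : M.left.Opens) [Nonempty W] (h : W ≤ A.U i ⊓ B.U j ⊓ C.U k),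
    ρC.lam k X = ρA.lam i X + ρB.lam j X +
      X.1 (toRat (res (e.c i j k) W h)) / toRat (res (e.c i j k) W h)

end LieAlgebraAction

end

end RelInv

/-! A rational section R is locally a fraction p / q in lowest terms, and lowest terms are unique up
to units. Hence the denominators q on the members of a cover differ by units and define an effective
Cartier divisor, and so do the numerators p once the transition functions of L are taken into
account. The line bundles of these divisors are L_Q and L_P, the local equations are the regular
sections Q and P, and R = P / Q.

Invariance is inherited. For G, the equation R(gx) = Φ R(x) becomes p(gx) q(x) = Φ p(x) q(gx), so
q(gx) divides q(x); the involution (g, x) ↦ (g⁻¹, gx) gives the converse, and the unit q(gx) / q(x)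
linearizes L_Q. For 𝔤, the equation X(R) = λ R becomes p X(q) = q (X(p) - λ p), so q divides X(q),
and X(q) / q is the lift. An absolute invariant is a section of the trivial bundle; there p and q
have the same cocycle.

Lowest terms exist because M is smooth. The completed local ring at a closed point is a power series
ring (`nonempty_adicCompletion_ringEquiv_mvPowerSeries`), which is factorial by Weierstrass
preparation (`uniqueFactorizationMonoid_fin`). Only one consequence is descended: the ideal {z | b ∣
a z} of denominators of a / b is principal in the completion, hence in the local ring by faithful
flatness (`Ideal.exists_denominators_eq_span`), hence near the point by finite generation
(`Ideal.exists_reduced_denominator`).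

Lowest terms are expressed by `CoprimeGerms`: p is a non-zero-divisor modulo q in every stalk. This
condition survives flat pull-back, in particular along the action and the projection G × M → M,
although G × M need not be integral. -/

namespace MvPowerSeries
-- Unique factorization in power series rings over an infinite field
variable {σ : Type*} [Finite σ] {R : Type*} [CommRing R]

theorem mem_span_range_X_pow_iff {n : ℕ} {f : MvPowerSeries σ R} :
    f ∈ (Ideal.span (Set.range X) : Ideal (MvPowerSeries σ R)) ^ n ↔
      ∀ d : σ →₀ ℕ, d.degree < n → coeff d f = 0 := by
  set e := (toAdicCompletionAlgEquiv σ R).toRingEquiv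
  have hJ : Ideal.map e (Ideal.span (Set.range X)) =
      (MvPolynomial.idealOfVars σ R).map (algebraMap _ (AdicCompletion _ _)) := by
    simp_rw [Ideal.map_span, ← Set.range_comp]
    congr 2; ext1
    simp [e, AdicCompletion.algebraMap_apply, ← MvPolynomial.coe_X, toAdicCompletion_coe]
  have h1 : f ∈ (Ideal.span (Set.range X) : Ideal (MvPowerSeries σ R)) ^ n ↔
      e f ∈ ((MvPolynomial.idealOfVars σ R).map (algebraMap _ (AdicCompletion
        (MvPolynomial.idealOfVars σ R) (MvPolynomial σ R)))) ^ n := by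
    rw [← hJ, ← Ideal.map_pow]
    constructor
    · exact Ideal.mem_map_of_mem _
    · intro h
      obtain ⟨x, hx, hxe⟩ := (Ideal.mem_map_of_equiv e _).1 h
      rwa [← e.injective hxe]
  -- In the completion of the polynomial ring, the n-th power of the finitely generated ideal of
  -- variables is the kernel of reduction modulo that power, and this reduction is truncation.
  have h2 := AdicCompletion.pow_smul_top_eq_ker_eval (M := MvPolynomial σ R) (n := n)
    (MvPolynomial.idealOfVars_fg σ R)
  have h3 := SetLike.ext_iff.1 h2 (e f)
  rw [LinearMap.mem_ker] at h3
  rw [h1, ← Ideal.map_pow]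
  rw [Ideal.smul_top_eq_map] at h3
  refine h3.trans ?_
  have h4 : AdicCompletion.eval (MvPolynomial.idealOfVars σ R) (MvPolynomial σ R) n (e f) =
    Submodule.Quotient.mk (truncTotal n f) := rfl
  rw [h4, Submodule.Quotient.mk_eq_zero, smul_eq_mul, Ideal.mul_top,
    MvPolynomial.mem_pow_idealOfVars_iff']
  exact forall₂_congr fun d hd ↦ by rw [coeff_truncTotal _ hd]
end MvPowerSeries

open Polynomial in
-- Modulo I the polynomial P is a power of X. Since X is prime over the residue field, every monic
-- divisor also reduces to a power of X.
theorem Polynomial.IsDistinguishedAt.of_dvd {R : Type*} [CommRing R] [IsDomain R] {I : Ideal R}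
    [I.IsMaximal] {P Q : R[X]} (hP : P.IsDistinguishedAt I) (hQ : Q.Monic) (h : Q ∣ P) :
    Q.IsDistinguishedAt I := by
  let := Ideal.Quotient.field I
  have h1 : Q.map (Ideal.Quotient.mk I) ∣ X ^ P.natDegree := by
    rw [← hP.map_eq_X_pow]; exact Polynomial.map_dvd _ h
  obtain ⟨i, hi, hass⟩ := (dvd_prime_pow Polynomial.prime_X _).1 h1
  have h2 : Q.map (Ideal.Quotient.mk I) = X ^ i :=
    eq_of_monic_of_associated (hQ.map _) (monic_X_pow i) hass
  have h3 : Q.natDegree = i := by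
    rw [← hQ.natDegree_map (Ideal.Quotient.mk I), h2, natDegree_X_pow]
  refine ⟨⟨fun {n} hn ↦ ?_⟩, hQ⟩
  rw [← Ideal.Quotient.eq_zero_iff_mem, ← coeff_map, h2, coeff_X_pow, if_neg (by lia)]

open Polynomial in
-- Weierstrass division identifies the quotients of R[X] and of R[[X]] by a distinguished
-- polynomial, so one is a domain if the other is.
theorem Polynomial.IsDistinguishedAt.prime_coe {R : Type*} [CommRing R] [IsDomain R] {I : Ideal R}
    [IsAdicComplete I R] {P : R[X]} (hP : P.IsDistinguishedAt I) (h : Prime P) :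
    Prime (P : PowerSeries R) := by
  have h0 : (P : PowerSeries R) ≠ 0 := by simpa using h.ne_zero
  rw [← Ideal.span_singleton_prime h0, ← Ideal.Quotient.isDomain_iff_prime]
  have : IsDomain (R[X] ⧸ Ideal.span {P}) :=
    (Ideal.Quotient.isDomain_iff_prime _).2 ((Ideal.span_singleton_prime h.ne_zero).2 h)
  exact (MulEquiv.isDomain_iff hP.algEquivQuotient.toMulEquiv).1 this

theorem Polynomial.associated_coe_powerSeries {R : Type*} [CommRing R] {p q : Polynomial R}
    (h : Associated p q) : Associated (p : PowerSeries R) q := by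
  obtain ⟨u, rfl⟩ := h
  rw [Polynomial.coe_mul]
  exact (associated_mul_unit_left _ _
    (u.isUnit.map (Polynomial.coeToPowerSeries.ringHom (R := R)))).symm

open PowerSeries in
-- By Weierstrass preparation f is a unit times a distinguished polynomial P. The prime factors of P
-- in the factorial ring R[X] have unit leading coefficients because P is monic; made monic, they
-- are distinguished and stay prime in R[[X]].
theorem PowerSeries.exists_prime_factors_of_map_residue_ne_zero {R : Type*} [CommRing R]
    [IsDomain R] [IsLocalRing R] [UniqueFactorizationMonoid R]
    [IsAdicComplete (IsLocalRing.maximalIdeal R) R] {f : PowerSeries R}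
    (hf : f.map (IsLocalRing.residue R) ≠ 0) :
    ∃ s : Multiset (PowerSeries R), (∀ p ∈ s, Prime p) ∧ Associated s.prod f := by
  obtain ⟨P, h, hP⟩ := f.exists_isWeierstrassFactorization hf
  have hPd := hP.isDistinguishedAt
  have key : ∀ s : Multiset (Polynomial R), (∀ p ∈ s, Prime p) → s.prod ∣ P →
      ∃ t : Multiset (PowerSeries R), (∀ p ∈ t, Prime p) ∧
        Associated t.prod (s.prod : PowerSeries R) := by
    intro s
    induction s using Multiset.induction with
    | empty => exact fun _ _ ↦ ⟨0, by simp, by simp⟩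
    | cons p s ih =>
      intro hs hd
      rw [Multiset.prod_cons] at hd
      obtain ⟨t, ht, hts⟩ := ih (fun p hp ↦ hs p (Multiset.mem_cons_of_mem hp))
        (dvd_of_mul_left_dvd hd)
      have hpp := hs p (Multiset.mem_cons_self _ _)
      obtain ⟨c, hc⟩ : p ∣ P := dvd_of_mul_right_dvd hd
      have hu : IsUnit p.leadingCoeff := by
        have := hPd.monic
        rw [Polynomial.Monic, hc, Polynomial.leadingCoeff_mul] at this
        exact IsUnit.of_mul_eq_one _ this
      obtain ⟨u, hu⟩ := hu
      have hass : Associated (p * Polynomial.C (↑u⁻¹ : R)) p :=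
        associated_mul_unit_left _ _ ((Units.isUnit _).map Polynomial.C)
      have hmonic : (p * Polynomial.C (↑u⁻¹ : R)).Monic := by
        rw [Polynomial.Monic, Polynomial.leadingCoeff_mul, ← hu]; simp
      have hprime := (hPd.of_dvd hmonic (hass.dvd.trans ⟨c, hc⟩)).prime_coe
        (hass.symm.prime hpp)
      refine ⟨(p * Polynomial.C (↑u⁻¹ : R) : Polynomial R) ::ₘ t, ?_, ?_⟩
      · intro q hq
        rcases Multiset.mem_cons.1 hq with rfl | hq
        exacts [hprime, ht q hq]
      · rw [Multiset.prod_cons, Multiset.prod_cons, Polynomial.coe_mul p s.prod]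
        exact Associated.mul_mul (Polynomial.associated_coe_powerSeries hass) hts
  obtain ⟨s, hs, u, hsu⟩ := UniqueFactorizationMonoid.exists_prime_factors P hPd.monic.ne_zero
  obtain ⟨t, ht, hts⟩ := key s hs ⟨u, hsu.symm⟩
  refine ⟨t, ht, hts.trans ?_⟩
  have h1 : Associated (s.prod : PowerSeries R) P :=
    Polynomial.associated_coe_powerSeries ⟨u, hsu⟩
  refine h1.trans ?_
  rw [hP.eq_mul]
  exact (associated_mul_unit_left _ _ hP.isUnit).symm

namespace MvPowerSeries
open Finsupp
variable {k : Type*} [Field k] {n : ℕ}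

/-- Restriction of a power series to the first coordinate axis. -/
noncomputable def axis (k : Type*) [Field k] (n : ℕ) :
    MvPowerSeries (Fin (n + 1)) k →+* PowerSeries k :=
  (PowerSeries.map constantCoeff).comp (finSuccEquiv k n).toRingEquiv.toRingHom

/-- The linear forms of a change of coordinates which moves the vector `c` to the first
coordinate axis. -/
noncomputable def shear (c : Fin (n + 1) → k) (i : Fin (n + 1)) : MvPowerSeries (Fin (n + 1)) k :=
  C (c i) * X 0 + if i = 0 then 0 else X i

/-- The linear forms of the inverse of the change of coordinates `shear c`. -/
noncomputable def unshear (c : Fin (n + 1) → k) (i : Fin (n + 1)) :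
    MvPowerSeries (Fin (n + 1)) k :=
  if i = 0 then C (c 0)⁻¹ * X 0 else X i - C (c i * (c 0)⁻¹) * X 0

theorem hasSubst_shear (c : Fin (n + 1) → k) : HasSubst (shear c) :=
  hasSubst_of_constantCoeff_zero fun i ↦ by unfold shear; split_ifs <;> simp

theorem hasSubst_unshear (c : Fin (n + 1) → k) : HasSubst (unshear c) :=
  hasSubst_of_constantCoeff_zero fun i ↦ by unfold unshear; split_ifs <;> simp

theorem substAlgHom_C' {σ τ : Type*} {a : σ → MvPowerSeries τ k} (ha : HasSubst a) (r : k) :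
    substAlgHom (R := k) ha (C r) = C r := by
  rw [substAlgHom_apply, subst_C]

/-- The change of coordinates `shear c`. -/
noncomputable def shearEquiv (c : Fin (n + 1) → k) (hc : c 0 ≠ 0) :
    MvPowerSeries (Fin (n + 1)) k ≃ₐ[k] MvPowerSeries (Fin (n + 1)) k :=
  AlgEquiv.ofAlgHom (substAlgHom (hasSubst_shear c)) (substAlgHom (hasSubst_unshear c))
    (by
      ext1 f
      simp only [AlgHom.comp_apply, AlgHom.id_apply]
      rw [substAlgHom_comp_substAlgHom_apply, substAlgHom_apply]
      refine Eq.trans ?_ (congrFun (subst_self (σ := Fin (n + 1)) (R := k)) f)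
      congr 1
      funext i
      by_cases hi : i = 0
      · subst hi
        simp only [unshear, if_true, map_mul, substAlgHom_C', substAlgHom_X]
        simp [shear, ← _root_.mul_assoc, ← map_mul, hc]
      · simp only [unshear, if_neg hi, map_sub, map_mul, substAlgHom_C', substAlgHom_X]
        simp only [shear, if_neg hi, if_true, add_zero, ← _root_.mul_assoc, ← map_mul]
        rw [inv_mul_cancel_right₀ hc]; ring)
    (by
      ext1 f
      simp only [AlgHom.comp_apply, AlgHom.id_apply]
      rw [substAlgHom_comp_substAlgHom_apply, substAlgHom_apply]
      refine Eq.trans ?_ (congrFun (subst_self (σ := Fin (n + 1)) (R := k)) f)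
      congr 1
      funext i
      by_cases hi : i = 0
      · subst hi
        simp only [shear, if_true, add_zero, map_mul, substAlgHom_C', substAlgHom_X]
        simp [unshear, ← _root_.mul_assoc, ← map_mul, hc]
      · simp only [shear, if_neg hi, map_add, map_mul, substAlgHom_C', substAlgHom_X]
        simp only [unshear, if_neg hi, if_true, ← _root_.mul_assoc, ← map_mul]
        ring)

theorem axis_shear (c : Fin (n + 1) → k) (i : Fin (n + 1)) :
    axis k n (shear c i) = PowerSeries.C (c i) * PowerSeries.X := by
  refine Fin.cases ?_ (fun j ↦ ?_) i
  · simp [axis, shear, finSuccEquiv_C, finSuccEquiv_X_zero]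
  · simp [axis, shear, finSuccEquiv_C, finSuccEquiv_X_zero, finSuccEquiv_X_succ]

theorem coeff_axis (f : MvPowerSeries (Fin (n + 1)) k) (d : ℕ) :
    PowerSeries.coeff d (axis k n f) = coeff (Finsupp.cons d 0) f := by
  rw [← coeff_coeff_finSuccEquiv]
  simp [axis]

/-- On the line through c, f(cT) = ∑ f_d(c) T^d with f_d the homogeneous part of degree d.
Truncation at d + 1 keeps degree d and makes f a polynomial. -/
theorem coeff_axis_subst_shear (c : Fin (n + 1) → k) (f : MvPowerSeries (Fin (n + 1)) k) (d : ℕ) :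
    PowerSeries.coeff d (axis k n (subst (shear c) f)) =
      MvPolynomial.eval c (MvPolynomial.homogeneousComponent d (truncTotal (d + 1) f)) := by
  classical
  have h1 : ∀ e : Fin (n + 1) →₀ ℕ,
      coeff (Finsupp.cons d 0) (e.prod fun s m ↦ shear c s ^ m) =
        if e.degree = d then e.prod fun s m ↦ c s ^ m else 0 := by
    intro e
    have : axis k n (e.prod fun s m ↦ shear c s ^ m) =
        PowerSeries.C (e.prod fun s m ↦ c s ^ m) * PowerSeries.X ^ e.degree := by
      simp only [Finsupp.prod, map_prod, map_pow, axis_shear, mul_pow, Finset.prod_mul_distrib,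
        Finset.prod_pow_eq_pow_sum, Finsupp.degree_apply]
    rw [← coeff_axis, this, PowerSeries.coeff_C_mul, PowerSeries.coeff_X_pow]
    simp [eq_comm]
  rw [coeff_axis, coeff_subst (hasSubst_shear c)]
  simp only [h1]
  rw [MvPolynomial.eval_eq', finsum_eq_sum_of_support_subset
    (s := (MvPolynomial.homogeneousComponent d (truncTotal (d + 1) f)).support)]
  · refine Finset.sum_congr rfl fun e he ↦ ?_
    rw [MvPolynomial.mem_support_iff, MvPolynomial.coeff_homogeneousComponent] at he
    rw [MvPolynomial.coeff_homogeneousComponent]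
    have : e.degree = d := by by_contra h; simp [h] at he
    rw [if_pos this, if_pos this, coeff_truncTotal _ (by omega), smul_eq_mul,
      Finsupp.prod_fintype _ _ (by simp)]
  · intro e he
    rw [Function.mem_support] at he
    rw [Finset.mem_coe, MvPolynomial.mem_support_iff, MvPolynomial.coeff_homogeneousComponent]
    have : e.degree = d := by by_contra h; simp [h] at he
    rw [if_pos this, coeff_truncTotal _ (by omega)]
    intro h; simp [h] at he

theorem exists_axis_shearEquiv_ne_zero [Infinite k] {f : MvPowerSeries (Fin (n + 1)) k}
    (hf : f ≠ 0) : ∃ (c : Fin (n + 1) → k) (hc : c 0 ≠ 0), axis k n (shearEquiv c hc f) ≠ 0 := by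
  obtain ⟨e, he⟩ : ∃ e, coeff e f ≠ 0 := by
    by_contra! h; exact hf (MvPowerSeries.ext (by simpa using h))
  set F := MvPolynomial.homogeneousComponent e.degree (truncTotal (e.degree + 1) f)
  have hF : F ≠ 0 := fun h ↦ he <| by
    have := congrArg (MvPolynomial.coeff e) h
    simpa [F, MvPolynomial.coeff_homogeneousComponent, coeff_truncTotal] using this
  -- The extra factor X 0 forces c 0 ≠ 0, which makes the shear invertible.
  obtain ⟨c, hc⟩ : ∃ c, MvPolynomial.eval c (F * MvPolynomial.X 0) ≠ 0 := by
    by_contra! h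
    exact mul_ne_zero hF (MvPolynomial.X_ne_zero 0) (MvPolynomial.funext fun x ↦ by simpa using h x)
  rw [map_mul, MvPolynomial.eval_X] at hc
  refine ⟨c, right_ne_zero_of_mul hc, fun h ↦ left_ne_zero_of_mul hc ?_⟩
  rw [← coeff_axis_subst_shear, ← substAlgHom_apply (hasSubst_shear c)]
  have := congrArg (PowerSeries.coeff e.degree) h
  rwa [map_zero] at this

theorem maximalIdeal_eq_span_range_X :
    IsLocalRing.maximalIdeal (MvPowerSeries (Fin n) k) = Ideal.span (Set.range X) := by
  ext f
  rw [IsLocalRing.mem_maximalIdeal, mem_nonunits_iff, isUnit_iff_constantCoeff, isUnit_iff_ne_zero,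
    not_not, ← pow_one (Ideal.span _), mem_span_range_X_pow_iff]
  simp [Finsupp.degree_eq_zero_iff]

instance isAdicComplete_maximalIdeal :
    IsAdicComplete (IsLocalRing.maximalIdeal (MvPowerSeries (Fin n) k))
      (MvPowerSeries (Fin n) k) := by
  rw [maximalIdeal_eq_span_range_X]; infer_instance

/-- Induction on the number of variables. After a linear change of coordinates f does not vanish on
the first axis, so as a series in the first variable it is non-zero modulo the maximal ideal of its
coefficient ring, and Weierstrass preparation applies. -/
instance uniqueFactorizationMonoid_fin [Infinite k] (n : ℕ) :
    UniqueFactorizationMonoid (MvPowerSeries (Fin n) k) := by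
  induction n with
  | zero =>
    exact (isEmptyEquiv (Fin 0) k).symm.toMulEquiv.uniqueFactorizationMonoid inferInstance
  | succ n ih =>
    refine UniqueFactorizationMonoid.of_exists_prime_factors fun f hf ↦ ?_
    obtain ⟨c, hc, hfc⟩ := exists_axis_shearEquiv_ne_zero hf
    set e : MvPowerSeries (Fin (n + 1)) k ≃+* PowerSeries (MvPowerSeries (Fin n) k) :=
      ((shearEquiv c hc).trans (finSuccEquiv k n)).toRingEquiv
    have h1 : (e f).map (IsLocalRing.residue _) ≠ 0 := by
      intro h
      refine hfc (PowerSeries.ext fun d ↦ ?_)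
      have := congrArg (PowerSeries.coeff d) h
      rw [PowerSeries.coeff_map, map_zero, IsLocalRing.residue_eq_zero_iff,
        IsLocalRing.mem_maximalIdeal, mem_nonunits_iff, isUnit_iff_constantCoeff,
        isUnit_iff_ne_zero, not_not] at this
      rw [map_zero, ← this]
      simp [axis, e]
    have : IsDomain (MvPowerSeries (Fin n) k) := NoZeroDivisors.to_isDomain _
    obtain ⟨s, hs, hsf⟩ := PowerSeries.exists_prime_factors_of_map_residue_ne_zero h1
    refine ⟨s.map e.symm, ?_, ?_⟩
    · intro p hp
      obtain ⟨q, hq, rfl⟩ := Multiset.mem_map.1 hp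
      exact (MulEquiv.prime_iff e.symm).2 (hs q hq)
    · have := hsf.map e.symm
      rwa [map_multiset_prod, e.symm_apply_apply] at this

end MvPowerSeries

/-! ### Completions of smooth local rings -/

theorem IsAdicComplete.sq {R : Type*} [CommRing R] (I : Ideal R) [IsAdicComplete I R] :
    IsAdicComplete (I ^ 2) R where
  haus' x hx := by
    refine IsHausdorff.haus' (I := I) x fun n ↦ (hx n).mono (Submodule.smul_mono_left ?_)
    rw [← pow_mul]
    exact Ideal.pow_le_pow_right (by lia)
  prec' f hf := by
    have hle (n : ℕ) : (I ^ 2) ^ n ≤ I ^ n := by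
      rw [← pow_mul]; exact Ideal.pow_le_pow_right (by lia)
    obtain ⟨L, hL⟩ := IsPrecomplete.prec' (I := I) f
      fun {m n} h ↦ (hf h).mono (Submodule.smul_mono_left (hle m))
    -- The I-adic limit is compared with the term of index 2n: both f n and L are congruent to it
    -- modulo I ^ (2 * n).
    refine ⟨L, fun n ↦ (hf (show n ≤ 2 * n by lia)).trans ?_⟩
    rw [← pow_mul]
    exact hL (2 * n)

/-- By `h` the maps A / I ^ n → P / J ^ n are injective, so the induced map on the completion is
injective. By `hs` the image of A is dense; approximations a n of p form a Cauchy sequence, again by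
`h`, and its class maps to p. -/
theorem AdicCompletion.nonempty_ringEquiv {A P : Type*} [CommRing A] [CommRing P] {I : Ideal A}
    {J : Ideal P} [IsAdicComplete J P] (g : A →+* P) (h : ∀ n a, g a ∈ J ^ n ↔ a ∈ I ^ n)
    (hs : ∀ n p, ∃ a, p - g a ∈ J ^ n) : Nonempty (AdicCompletion I A ≃+* P) := by
  let f (n : ℕ) : AdicCompletion I A →+* P ⧸ J ^ n :=
    (Ideal.quotientMap (J ^ n) g fun a ha ↦ (h n a).2 ha).comp
      (AdicCompletion.evalₐ I n : AdicCompletion I A →+* A ⧸ I ^ n)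
  have hfmk (n : ℕ) (x : AdicCompletion.AdicCauchySequence I A) :
      f n (AdicCompletion.mk I A x) = Ideal.Quotient.mk _ (g (x.val n)) := by
    rw [← Ideal.quotientMap_mk (H := fun a ha ↦ (h n a).2 ha), ← AdicCompletion.evalₐ_mk]
    rfl
  have hf {m n : ℕ} (hle : m ≤ n) : (Ideal.Quotient.factorPow J hle).comp (f n) = f m := by
    ext x
    obtain ⟨x, rfl⟩ := AdicCompletion.mk_surjective I A x
    rw [RingHom.comp_apply, hfmk, hfmk]
    change Ideal.Quotient.mk _ _ = _
    rw [Ideal.Quotient.mk_eq_mk_iff_sub_mem, ← map_sub, h]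
    have := x.2 hle
    rw [SModEq.sub_mem, smul_eq_mul, Ideal.mul_top] at this
    rw [← neg_sub]
    exact neg_mem this
  refine ⟨RingEquiv.ofBijective (IsAdicComplete.liftRingHom J f hf) ⟨?_, ?_⟩⟩
  · rw [injective_iff_map_eq_zero]
    intro x hx
    obtain ⟨x, rfl⟩ := AdicCompletion.mk_surjective I A x
    apply AdicCompletion.ext_evalₐ
    intro n
    have := IsAdicComplete.mk_liftRingHom J f hf n (AdicCompletion.mk I A x)
    rw [hx, hfmk, _root_.map_zero, eq_comm, Ideal.Quotient.eq_zero_iff_mem, h] at this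
    rwa [AdicCompletion.evalₐ_mk, _root_.map_zero, Ideal.Quotient.eq_zero_iff_mem]
  · intro p
    choose a ha using fun n ↦ hs n p
    let x : AdicCompletion.AdicCauchySequence I A := AdicCompletion.AdicCauchySequence.mk I A a
      fun n ↦ by
        rw [SModEq.sub_mem, smul_eq_mul, Ideal.mul_top, ← h, map_sub]
        have := sub_mem (Ideal.pow_le_pow_right n.le_succ (ha (n + 1))) (ha n)
        simpa using this
    refine ⟨AdicCompletion.mk I A x, ?_⟩
    rw [← sub_eq_zero]
    refine IsHausdorff.haus' (I := J) _ fun n ↦ ?_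
    rw [SModEq.sub_mem, smul_eq_mul, Ideal.mul_top, sub_zero, ← Ideal.Quotient.eq_zero_iff_mem,
      map_sub, IsAdicComplete.mk_liftRingHom, hfmk, ← map_sub, Ideal.Quotient.eq_zero_iff_mem,
      ← neg_sub]
    exact neg_mem (ha n)

namespace IsLocalRing
variable {k A : Type*} [Field k] [CommRing A] [Algebra k A] [IsLocalRing A] [IsNoetherianRing A]

omit [IsNoetherianRing A] in
theorem exists_algebraMap_sub_mem (hk : Function.Surjective (algebraMap k (ResidueField A)))
    (a : A) : ∃ c : k, a - algebraMap k A c ∈ maximalIdeal A := by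
  obtain ⟨c, hc⟩ := hk (residue A a)
  refine ⟨c, ?_⟩
  rw [← residue_eq_zero_iff, map_sub, ← hc, sub_eq_zero]
  rfl

/-- Generators of the maximal ideal which are linearly independent modulo its square. -/
theorem exists_generators (k : Type*) [Field k] [Algebra k A] :
    ∃ (n : ℕ) (x : Fin n → A), Ideal.span (Set.range x) = maximalIdeal A ∧
      ∀ c : Fin n → k, ∑ i, algebraMap k A (c i) * x i ∈ maximalIdeal A ^ 2 → ∀ i, c i = 0 := by
  let b := Module.finBasis (ResidueField A) (CotangentSpace A)
  choose x hx using fun i ↦ (maximalIdeal A).toCotangent_surjective (b i)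
  refine ⟨_, fun i ↦ (x i : A), ?_, ?_⟩
  · have h1 : Submodule.span A (Set.range x) = ⊤ := by
      rw [← CotangentSpace.span_image_eq_top_iff, ← Set.range_comp]
      convert b.span_eq using 2
      exact congrArg Set.range (funext hx)
    have := congrArg (Submodule.map (maximalIdeal A).subtype) h1
    rw [Submodule.map_span, ← Set.range_comp, Submodule.map_subtype_top] at this
    exact this
  · intro c hc i
    have h1 : (∑ i, algebraMap k A (c i) * (x i : A)) =
        ((∑ i, algebraMap k A (c i) • x i : maximalIdeal A) : A) := by
      simp [Algebra.smul_def]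
    rw [h1, ← Ideal.toCotangent_eq_zero, map_sum] at hc
    simp only [map_smul, hx] at hc
    have h2 := Fintype.linearIndependent_iff.1 b.linearIndependent
      (fun i ↦ residue A (algebraMap k A (c i))) hc i
    have h3 : algebraMap k (ResidueField A) (c i) = 0 := h2
    exact (map_eq_zero _).1 h3

end IsLocalRing

namespace IsLocalRing
open MvPowerSeries
variable {k A : Type*} [Field k] [CommRing A] [Algebra k A] [IsLocalRing A] [IsNoetherianRing A]

/-- The evaluation of a power series at elements of an ideal, modulo a power of the ideal. -/
noncomputable def evalQuot {σ : Type*} [Finite σ] {A : Type*} [CommRing A] [Algebra k A]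
    (I : Ideal A) (x : σ → A) (hx : ∀ i, x i ∈ I) (n : ℕ) :
    MvPowerSeries σ k →ₐ[k] A ⧸ I ^ n :=
  (Ideal.Quotient.liftₐ (MvPolynomial.idealOfVars σ k ^ n)
    ((Ideal.Quotient.mkₐ k (I ^ n)).comp (MvPolynomial.aeval x)) fun a ha ↦ by
      rw [AlgHom.comp_apply, Ideal.Quotient.mkₐ_eq_mk, Ideal.Quotient.eq_zero_iff_mem]
      have h1 : (MvPolynomial.idealOfVars σ k).map (MvPolynomial.aeval x : _ →ₐ[k] A) ≤ I := by
        rw [MvPolynomial.idealOfVars, Ideal.map_span, Ideal.span_le]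
        rintro _ ⟨_, ⟨i, rfl⟩, rfl⟩
        simpa using hx i
      have := Ideal.mem_map_of_mem (MvPolynomial.aeval x : _ →ₐ[k] A) ha
      rw [Ideal.map_pow] at this
      exact Ideal.pow_right_mono h1 n this).comp
    ((truncTotalAlgHom σ k n).restrictScalars k)

theorem evalQuot_coe {σ : Type*} [Finite σ] {A : Type*} [CommRing A] [Algebra k A]
    (I : Ideal A) (x : σ → A) (hx : ∀ i, x i ∈ I) (n : ℕ) (p : MvPolynomial σ k) :
    evalQuot I x hx n (p : MvPowerSeries σ k) = Ideal.Quotient.mk _ (MvPolynomial.aeval x p) := by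
  have : truncTotalAlgHom σ k n (p : MvPowerSeries σ k) = Ideal.Quotient.mk _ p :=
    (truncTotalAlgHom σ k n).commutes p
  rw [evalQuot, AlgHom.comp_apply, AlgHom.restrictScalars_apply, this]
  rfl

/-- The rings A / m ^ 2 and k[[X]] / J ^ 2 agree. Formal smoothness lifts this identification to a
map g from A to k[[X]], and agreement to first order propagates to every order because m ^ i and J ^
i are spanned by products. Mapping A to the power series, rather than the reverse, makes dimension
theory unnecessary. -/
theorem nonempty_adicCompletion_ringEquiv_mvPowerSeries [Algebra.FormallySmooth k A]
    (hk : Function.Surjective (algebraMap k (ResidueField A))) :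
    ∃ n : ℕ, Nonempty (AdicCompletion (maximalIdeal A) A ≃+* MvPowerSeries (Fin n) k) := by
  obtain ⟨n, x, hspan, hind⟩ := exists_generators (A := A) k
  set m := maximalIdeal A
  refine ⟨n, ?_⟩
  set J : Ideal (MvPowerSeries (Fin n) k) := Ideal.span (Set.range X)
  have hx (i : Fin n) : x i ∈ m := hspan ▸ Ideal.subset_span ⟨i, rfl⟩
  have hXJ (i : Fin n) : (X i : MvPowerSeries (Fin n) k) ∈ J := Ideal.subset_span ⟨i, rfl⟩
  -- linear approximation in the local ring and in the ring of power series
  have hlinA (y : A) (hy : y ∈ m) : ∃ c : Fin n → k, y - ∑ i, algebraMap k A (c i) * x i ∈ m ^ 2 := by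
    rw [← hspan, Ideal.mem_span_range_iff_exists_fun] at hy
    obtain ⟨a, rfl⟩ := hy
    choose c hc using fun i ↦ exists_algebraMap_sub_mem hk (a i)
    refine ⟨c, ?_⟩
    rw [← Finset.sum_sub_distrib]
    refine sum_mem fun i _ ↦ ?_
    rw [← sub_mul, sq]
    exact Ideal.mul_mem_mul (hc i) (hx i)
  have hlinP (f : MvPowerSeries (Fin n) k) :
      f - (C (constantCoeff f) + ∑ i, C (coeff (Finsupp.single i 1) f) * X i) ∈ J ^ 2 := by
    classical
    rw [mem_span_range_X_pow_iff]
    intro d hd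
    obtain h | h : d.degree = 0 ∨ d.degree = 1 := by lia
    · rw [Finsupp.degree_eq_zero_iff] at h
      subst h
      simp
    · obtain ⟨i, rfl⟩ := (Set.ext_iff.1 Finsupp.range_single_one d).2 h
      simp [coeff_C, coeff_C_mul, coeff_X, Finsupp.single_left_inj]
  -- the power series ring agrees with the local ring to first order
  set φ := evalQuot (k := k) m x hx 2 with hφdef
  have hφX (i : Fin n) : φ (X i) = Ideal.Quotient.mk _ (x i) := by
    rw [← MvPolynomial.coe_X, hφdef, evalQuot_coe, MvPolynomial.aeval_X]
  have hφC (c : k) : φ (C c) = Ideal.Quotient.mk _ (algebraMap k A c) := φ.commutes c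
  have hJker : J ^ 2 ≤ RingHom.ker φ := by
    have h1 : J.map φ ≤ m.map (Ideal.Quotient.mk (m ^ 2)) := by
      rw [Ideal.map_span, Ideal.span_le]
      rintro _ ⟨_, ⟨i, rfl⟩, rfl⟩
      rw [hφX]
      exact Ideal.mem_map_of_mem _ (hx i)
    intro f hf
    have h2 := Ideal.mem_map_of_mem φ hf
    rw [Ideal.map_pow] at h2
    have h3 := Ideal.pow_right_mono h1 2 h2
    rwa [← Ideal.map_pow, Ideal.map_quotient_self, Ideal.mem_bot] at h3
  have hφ (f : MvPowerSeries (Fin n) k) : φ f = Ideal.Quotient.mk _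
      (algebraMap k A (constantCoeff f) +
        ∑ i, algebraMap k A (coeff (Finsupp.single i 1) f) * x i) := by
    have := hJker (hlinP f)
    rw [RingHom.mem_ker, map_sub, sub_eq_zero] at this
    rw [this]
    simp only [map_add, map_sum, map_mul, hφX, hφC]
  have hm2 : m ^ 2 ≤ m := Ideal.pow_le_self two_ne_zero
  have hconst (f : MvPowerSeries (Fin n) k) (a : A) (ha : a ∈ m)
      (h : φ f = Ideal.Quotient.mk _ a) : constantCoeff f = 0 := by
    rw [hφ, Ideal.Quotient.mk_eq_mk_iff_sub_mem] at h
    have h1 : algebraMap k A (constantCoeff f) ∈ m := by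
      have h2 : ∑ i, algebraMap k A (coeff (Finsupp.single i 1) f) * x i ∈ m :=
        sum_mem fun i _ ↦ Ideal.mul_mem_left _ _ (hx i)
      have := sub_mem (add_mem (hm2 h) ha) h2
      simpa using this
    by_contra h0
    exact (mem_maximalIdeal _).1 h1 ((Ne.isUnit h0).map (algebraMap k A))
  -- The independence of the x i modulo m ^ 2 kills the linear coefficients of a series in the
  -- kernel.
  have hker : RingHom.ker φ = J ^ 2 := by
    refine le_antisymm (fun f hf ↦ ?_) hJker
    rw [RingHom.mem_ker] at hf
    have h0 := hconst f 0 (zero_mem _) (by rw [hf, map_zero])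
    have h1 := hf
    rw [hφ, h0, map_zero, zero_add, Ideal.Quotient.eq_zero_iff_mem] at h1
    have h2 := hlinP f
    simpa [h0, hind _ h1] using h2
  have hφsurj : Function.Surjective φ := by
    intro b
    obtain ⟨a, rfl⟩ := Ideal.Quotient.mk_surjective b
    obtain ⟨c, hc⟩ := exists_algebraMap_sub_mem hk a
    obtain ⟨d, hd⟩ := hlinA _ hc
    refine ⟨C c + ∑ i, C (d i) * X i, ?_⟩
    rw [← Ideal.Quotient.mk_eq_mk_iff_sub_mem] at hd
    simp only [map_add, map_sum, map_mul, hφX, hφC, map_sub] at hd ⊢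
    rw [← hd]
    ring
  have : IsAdicComplete (RingHom.ker φ) (MvPowerSeries (Fin n) k) := by
    rw [hker]; exact IsAdicComplete.sq J
  -- The lift of A → A / m ^ 2 ≅ k[[X]] / ker φ through the (ker φ)-adically complete ring k[[X]].
  obtain ⟨g, hg'⟩ := Algebra.FormallySmooth.exists_mkₐ_comp_eq_of_isAdicComplete (R := k)
    (I := RingHom.ker φ) ((Ideal.quotientKerAlgEquivOfSurjective hφsurj).symm.toAlgHom.comp
      (Ideal.Quotient.mkₐ k (m ^ 2)))
  have hg (a : A) : φ (g a) = Ideal.Quotient.mk _ a := by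
    have := congrArg (Ideal.quotientKerAlgEquivOfSurjective hφsurj) (DFunLike.congr_fun hg' a)
    simpa using this
  have hgm (a : A) (ha : a ∈ m) : g a ∈ J := by
    rw [← pow_one J, mem_span_range_X_pow_iff]
    intro d hd
    rw [(Finsupp.degree_eq_zero_iff d).1 (by lia)]
    simpa using hconst _ a ha (hg a)
  have hgpow (i : ℕ) (a : A) (ha : a ∈ m ^ i) : g a ∈ J ^ i := by
    have := Ideal.mem_map_of_mem g ha
    rw [Ideal.map_pow] at this
    exact Ideal.pow_right_mono (Ideal.map_le_iff_le_comap.2 hgm) i this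
  have hgx (i : Fin n) : g (x i) - X i ∈ J ^ 2 := by
    rw [← hker, RingHom.mem_ker, map_sub, hg, hφX, sub_self]
  have hcoe (i : ℕ) (F : MvPolynomial (Fin n) k) : F ∈ MvPolynomial.idealOfVars (Fin n) k ^ i ↔
      (F : MvPowerSeries (Fin n) k) ∈ J ^ i := by
    rw [mem_span_range_X_pow_iff, MvPolynomial.mem_pow_idealOfVars_iff']
    simp
  have haeval (i : ℕ) (F : MvPolynomial (Fin n) k)
      (hF : F ∈ MvPolynomial.idealOfVars (Fin n) k ^ i) : MvPolynomial.aeval x F ∈ m ^ i := by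
    have h1 : (MvPolynomial.idealOfVars (Fin n) k).map (MvPolynomial.aeval x : _ →ₐ[k] A) ≤ m := by
      rw [MvPolynomial.idealOfVars, Ideal.map_span, Ideal.span_le]
      rintro _ ⟨_, ⟨i, rfl⟩, rfl⟩
      simpa using hx i
    have := Ideal.mem_map_of_mem (MvPolynomial.aeval x : _ →ₐ[k] A) hF
    rw [Ideal.map_pow] at this
    exact Ideal.pow_right_mono h1 i this
  -- approximation by polynomials
  have hone (a : A) (ha : a ∈ m) : ∃ F ∈ MvPolynomial.idealOfVars (Fin n) k,
      a - MvPolynomial.aeval x F ∈ m ^ 2 ∧ g a - F ∈ J ^ 2 := by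
    obtain ⟨c, hc⟩ := hlinA a ha
    refine ⟨∑ i, MvPolynomial.C (c i) * MvPolynomial.X i, sum_mem fun i _ ↦
      Ideal.mul_mem_left _ _ (Ideal.subset_span ⟨i, rfl⟩), by simpa using hc, ?_⟩
    have h1 := hgpow 2 _ hc
    have h2 : ∑ i, C (c i) * (g (x i) - X i) ∈ J ^ 2 :=
      sum_mem fun i _ ↦ Ideal.mul_mem_left _ _ (hgx i)
    have h3 (r : k) : g (algebraMap k A r) = C r := g.commutes r
    have h4 : ((∑ i, MvPolynomial.C (c i) * MvPolynomial.X i : MvPolynomial (Fin n) k) :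
        MvPowerSeries (Fin n) k) = ∑ i, C (c i) * X i := by
      rw [← MvPolynomial.coeToMvPowerSeries.ringHom_apply, map_sum]
      simp
    rw [h4]
    convert add_mem h1 h2 using 1
    simp only [map_sub, map_sum, map_mul, h3, mul_sub, Finset.sum_sub_distrib]
    ring
  have happrox (i : ℕ) : ∀ a ∈ m ^ i, ∃ F ∈ MvPolynomial.idealOfVars (Fin n) k ^ i,
      a - MvPolynomial.aeval x F ∈ m ^ (i + 1) ∧ g a - F ∈ J ^ (i + 1) := by
    induction i with
    | zero =>
      intro a _
      obtain ⟨c, hc⟩ := exists_algebraMap_sub_mem hk a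
      refine ⟨MvPolynomial.C c, by simp, ?_, ?_⟩
      · rwa [zero_add, pow_one, MvPolynomial.aeval_C]
      have := hgm _ hc
      rw [map_sub, show g (algebraMap k A c) = C c from g.commutes c] at this
      simpa using this
    | succ i ih =>
      intro a ha
      rw [pow_succ'] at ha
      induction ha using Submodule.mul_induction_on' with
      | mem_mul_mem y hy b hb =>
        obtain ⟨F, hF, hF1, hF2⟩ := hone y hy
        obtain ⟨G, hG, hG1, hG2⟩ := ih b hb
        refine ⟨F * G, by rw [pow_succ']; exact Ideal.mul_mem_mul hF hG, ?_, ?_⟩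
        · have h1 := Ideal.mul_mem_mul hF1 hb
          have h2 := Ideal.mul_mem_mul (haeval 1 F (by simpa using hF)) hG1
          rw [← pow_add] at h1 h2
          rw [show i + 1 + 1 = 2 + i by ring]
          rw [show 1 + (i + 1) = 2 + i by ring] at h2
          convert add_mem h1 h2 using 1
          rw [map_mul]; ring
        · have h1 := Ideal.mul_mem_mul hF2 (hgpow i b hb)
          have h2 := Ideal.mul_mem_mul ((hcoe 1 F).1 (by simpa using hF)) hG2
          rw [← pow_add] at h1 h2
          rw [show i + 1 + 1 = 2 + i by ring]
          rw [show 1 + (i + 1) = 2 + i by ring] at h2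
          convert add_mem h1 h2 using 1
          rw [map_mul, MvPolynomial.coe_mul]; ring
      | add a _ b _ ha hb =>
        obtain ⟨F, hF, hF1, hF2⟩ := ha
        obtain ⟨G, hG, hG1, hG2⟩ := hb
        refine ⟨F + G, add_mem hF hG, ?_, ?_⟩
        · convert add_mem hF1 hG1 using 1
          rw [map_add]; ring
        · convert add_mem hF2 hG2 using 1
          rw [map_add, MvPolynomial.coe_add]; ring
  -- The order of a is raised one step at a time: if a ∈ m ^ i is approximated by F and g a ∈ J ^ (i
  -- + 1), then F has order at least i + 1, so F(x), and with it a, lies in m ^ (i + 1).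
  have hinj (j : ℕ) (a : A) : g a ∈ J ^ j ↔ a ∈ m ^ j := by
    refine ⟨fun h ↦ ?_, hgpow j a⟩
    suffices ∀ i ≤ j, a ∈ m ^ i from this j le_rfl
    intro i
    induction i with
    | zero => simp
    | succ i ih =>
      intro hij
      obtain ⟨F, hF, hF1, hF2⟩ := happrox i a (ih (by lia))
      have h1 : (F : MvPowerSeries (Fin n) k) ∈ J ^ (i + 1) := by
        have := sub_mem (Ideal.pow_le_pow_right hij h) hF2
        simpa using this
      have := add_mem hF1 (haeval _ F ((hcoe _ F).2 h1))
      simpa using this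
  have hstep0 (p : MvPowerSeries (Fin n) k) : ∃ a, p - g a ∈ J ^ 2 := by
    obtain ⟨a, ha⟩ := Ideal.Quotient.mk_surjective (φ p)
    refine ⟨a, ?_⟩
    rw [← hker, RingHom.mem_ker, map_sub, hg, ha, sub_self]
  have hstep (i : ℕ) : ∀ p ∈ J ^ i, ∃ a, p - g a ∈ J ^ (i + 1) := by
    induction i with
    | zero =>
      intro p _
      obtain ⟨a, ha⟩ := hstep0 p
      exact ⟨a, Ideal.pow_le_pow_right (by lia) ha⟩
    | succ i ih =>
      intro p hp
      rw [pow_succ'] at hp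
      induction hp using Submodule.mul_induction_on' with
      | mem_mul_mem y hy b hb =>
        obtain ⟨u, hu⟩ := hstep0 y
        obtain ⟨v, hv⟩ := ih b hb
        refine ⟨u * v, ?_⟩
        have hgu : g u ∈ J := by
          have := sub_mem hy (Ideal.pow_le_self two_ne_zero hu)
          simpa using this
        have h1 := Ideal.mul_mem_mul hu hb
        have h2 := Ideal.mul_mem_mul (show g u ∈ J ^ 1 by simpa using hgu) hv
        rw [← pow_add] at h1 h2
        rw [show i + 1 + 1 = 2 + i by ring]
        rw [show 1 + (i + 1) = 2 + i by ring] at h2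
        convert add_mem h1 h2 using 1
        rw [map_mul]; ring
      | add a _ b _ ha hb =>
        obtain ⟨u, hu⟩ := ha
        obtain ⟨v, hv⟩ := hb
        refine ⟨u + v, ?_⟩
        convert add_mem hu hv using 1
        rw [map_add]; ring
  refine AdicCompletion.nonempty_ringEquiv (J := J) g.toRingHom hinj fun j p ↦ ?_
  induction j with
  | zero => exact ⟨0, by simp⟩
  | succ j ih =>
    obtain ⟨a, ha⟩ := ih
    obtain ⟨b, hb⟩ := hstep j _ ha
    refine ⟨a + b, ?_⟩
    convert hb using 1
    rw [map_add]
    exact (sub_sub _ _ _).symm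

theorem uniqueFactorizationMonoid_adicCompletion [Infinite k] [Algebra.FormallySmooth k A]
    (hk : Function.Surjective (algebraMap k (ResidueField A))) :
    UniqueFactorizationMonoid (AdicCompletion (maximalIdeal A) A) := by
  obtain ⟨n, ⟨e⟩⟩ := nonempty_adicCompletion_ringEquiv_mvPowerSeries hk
  exact e.symm.toMulEquiv.uniqueFactorizationMonoid inferInstance

end IsLocalRing

/-! ### Descent of reduced denominators from the completion -/

/-- The equational criterion of flatness for the relation a z - b w = 0: its solutions over B are
combinations of solutions over A. -/
theorem Module.Flat.exists_of_mul_eq_mul {A B : Type*} [CommRing A] [CommRing B] [Algebra A B]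
    [Module.Flat A B] {a b : A} {z w : B} (h : algebraMap A B a * z = algebraMap A B b * w) :
    ∃ (n : ℕ) (c d : Fin n → A) (y : Fin n → B), (∀ i, a * c i = b * d i) ∧
      z = ∑ i, algebraMap A B (c i) * y i := by
  have h1 : ∑ i : Fin 2, (![a, -b] i) • (![z, w] i) = 0 := by
    rw [Fin.sum_univ_two]
    simp [Algebra.smul_def, h]
  obtain ⟨n, c, y, h3, h4⟩ := Module.Flat.isTrivialRelation_of_sum_smul_eq_zero (R := A) (M := B) h1
  refine ⟨n, c 0, c 1, y, fun i ↦ ?_, ?_⟩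
  · have := h4 i
    simp [Fin.sum_univ_two] at this
    linear_combination this
  · simpa [Algebra.smul_def] using h3 0

/-- The ideal of the `z` such that `b` divides `a * z`, the denominators of `a / b`. -/
def Ideal.denominators {A : Type*} [CommRing A] (a b : A) : Ideal A where
  carrier := {z | b ∣ a * z}
  add_mem' h h' := by rw [Set.mem_ofPred_eq, mul_add]; exact dvd_add h h'
  zero_mem' := by simp
  smul_mem' c z h := by
    rw [Set.mem_ofPred_eq, smul_eq_mul, mul_left_comm]; exact Dvd.dvd.mul_left h c

theorem Ideal.mem_denominators {A : Type*} [CommRing A] {a b z : A} :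
    z ∈ Ideal.denominators a b ↔ b ∣ a * z := Iff.rfl

theorem Ideal.mem_map_denominators {A B : Type*} [CommRing A] [CommRing B] [Algebra A B]
    [Module.Flat A B] {a b : A} {z : B} (h : algebraMap A B b ∣ algebraMap A B a * z) :
    z ∈ (Ideal.denominators a b).map (algebraMap A B) := by
  obtain ⟨w, hw⟩ := h
  obtain ⟨n, c, d, y, hcd, rfl⟩ := Module.Flat.exists_of_mul_eq_mul hw
  exact _root_.sum_mem fun i _ ↦ Ideal.mul_mem_right _ _
    (Ideal.mem_map_of_mem _ (Ideal.mem_denominators.2 ⟨d i, hcd i⟩))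

/-- In the factorial completion B the ideal of denominators is generated by the reduced denominator
b', and by flatness it is extended from A. If no element of A in it generated it over B, the
extended ideal would lie in b' times the maximal ideal, which excludes b'. A generator q from A also
generates over A, since q B ∩ A = q A. -/
theorem Ideal.exists_denominators_eq_span {A : Type*} [CommRing A] [IsDomain A] [IsLocalRing A]
    [IsNoetherianRing A]
    [UniqueFactorizationMonoid (AdicCompletion (IsLocalRing.maximalIdeal A) A)] (a : A) {b : A}
    (hb : b ≠ 0) : ∃ q, Ideal.denominators a b = Ideal.span {q} := by
  set B := AdicCompletion (IsLocalRing.maximalIdeal A) A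
  have : Module.FaithfullyFlat A B := Module.FaithfullyFlat.of_flat_of_isLocalHom
  have hinj : Function.Injective (algebraMap A B) := FaithfulSMul.algebraMap_injective A B
  have hb' : algebraMap A B b ≠ 0 := by rwa [Ne, map_eq_zero_iff _ hinj]
  obtain ⟨a', b', d, hrel, ha, hbd⟩ :=
    UniqueFactorizationMonoid.exists_reduced_factors' (algebraMap A B a) (algebraMap A B b) hb'
  have hd : d ≠ 0 := by rintro rfl; simp [← hbd] at hb'
  have hb0 : b' ≠ 0 := by rintro rfl; simp [← hbd] at hb'
  have hmem (z : B) : algebraMap A B b ∣ algebraMap A B a * z ↔ b' ∣ z := by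
    rw [← ha, ← hbd, _root_.mul_assoc]
    constructor
    · intro h
      obtain ⟨w, hw⟩ := h
      rw [_root_.mul_assoc] at hw
      exact hrel.symm.dvd_of_dvd_mul_left ⟨w, mul_left_cancel₀ hd hw⟩
    · rintro ⟨w, rfl⟩
      exact ⟨a' * w, by ring⟩
  obtain ⟨q, hq, hqu⟩ : ∃ q ∈ Ideal.denominators a b, algebraMap A B q ∣ b' := by
    by_contra! h
    have h1 : (Ideal.denominators a b).map (algebraMap A B) ≤
        Ideal.span {b'} * IsLocalRing.maximalIdeal B := by
      rw [Ideal.map_le_iff_le_comap]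
      intro z hz
      obtain ⟨t, ht⟩ := (hmem _).1 (by rw [← map_mul]; exact map_dvd (algebraMap A B) hz)
      rw [Ideal.mem_comap, ht]
      refine Ideal.mul_mem_mul (Ideal.mem_span_singleton_self _)
        ((IsLocalRing.mem_maximalIdeal _).2 fun hu ↦ h z hz ?_)
      rw [ht]
      obtain ⟨u, rfl⟩ := hu
      exact ⟨↑u⁻¹, by simp [_root_.mul_assoc]⟩
    have h2 := h1 (Ideal.mem_map_denominators ((hmem b').2 dvd_rfl))
    obtain ⟨t, ht, htb⟩ := Ideal.mem_span_singleton_mul.1 h2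
    have : t = 1 := mul_left_cancel₀ hb0 (by rw [htb, _root_.mul_one])
    exact (IsLocalRing.mem_maximalIdeal _).1 ht (this ▸ isUnit_one)
  refine ⟨q, le_antisymm (fun z hz ↦ ?_) ((Ideal.span_singleton_le_iff_mem _).2 hq)⟩
  rw [← Ideal.comap_map_eq_self_of_faithfullyFlat (B := B) (Ideal.span {q}), Ideal.mem_comap,
    Ideal.map_span, Set.image_singleton, Ideal.mem_span_singleton]
  exact hqu.trans ((hmem _).1 (by rw [← map_mul]; exact map_dvd (algebraMap A B) hz))

theorem Ideal.exists_reduced_denominator (k : Type*) {A : Type*} [Field k] [IsAlgClosed k] [Infinite k]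
    [CommRing A] [IsDomain A] [Algebra k A] [Algebra.Smooth k A] (m : Ideal A) [m.IsMaximal] (a : A)
    {b : A} (hb : b ≠ 0) :
    ∃ q s : A, s ∉ m ∧ b ∣ a * q ∧ ∀ z, b ∣ a * z → q ∣ s * z := by
  have : IsNoetherianRing A := Algebra.FiniteType.isNoetherianRing k A
  let L := Localization.AtPrime m
  have : IsNoetherianRing L := IsLocalization.isNoetherianRing m.primeCompl _ inferInstance
  have : IsDomain L := IsLocalization.isDomain_localization m.primeCompl_le_nonZeroDivisors
  have : Algebra.FormallySmooth A L := Algebra.FormallySmooth.of_isLocalization m.primeCompl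
  have : Algebra.FormallySmooth k L := Algebra.FormallySmooth.comp k A L
  -- Nullstellensatz: the residue field at a maximal ideal is k.
  have hk : Function.Surjective (algebraMap k (IsLocalRing.ResidueField L)) := by
    let := Ideal.Quotient.field m
    have : Module.Finite k (A ⧸ m) := finite_of_finite_type_of_isJacobsonRing k (A ⧸ m)
    have h1 : Function.Surjective (algebraMap k (A ⧸ m)) :=
      (IsAlgClosed.algebraMap_bijective_of_isIntegral (k := k) (K := A ⧸ m)).2
    have h2 : Function.Surjective (algebraMap (A ⧸ m) m.ResidueField) :=
      (Ideal.bijective_algebraMap_quotient_residueField m).2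
    have h3 : (algebraMap k (IsLocalRing.ResidueField L)) =
        (algebraMap (A ⧸ m) m.ResidueField).comp (algebraMap k (A ⧸ m)) := by
      rfl
    rw [h3]
    exact h2.comp h1
  have := IsLocalRing.uniqueFactorizationMonoid_adicCompletion hk
  have hinj : Function.Injective (algebraMap A L) :=
    IsLocalization.injective _ m.primeCompl_le_nonZeroDivisors
  obtain ⟨q, hq⟩ := Ideal.exists_denominators_eq_span (algebraMap A L a)
    (show algebraMap A L b ≠ 0 by rwa [Ne, map_eq_zero_iff _ hinj])
  obtain ⟨q₀, t, rfl⟩ := IsLocalization.exists_mk'_eq m.primeCompl q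
  have hspan : Ideal.span {IsLocalization.mk' L q₀ t} = Ideal.span {algebraMap A L q₀} := by
    rw [← IsLocalization.mk'_spec L q₀ t,
      Ideal.span_singleton_mul_right_unit (IsLocalization.map_units L t)]
  rw [hspan] at hq
  have hmem (z : L) : algebraMap A L b ∣ algebraMap A L a * z ↔ algebraMap A L q₀ ∣ z := by
    rw [← Ideal.mem_denominators, hq, Ideal.mem_span_singleton]
  have hdiv {x y : A} (h : algebraMap A L x ∣ algebraMap A L y) : ∃ s ∉ m, x ∣ s * y := by
    obtain ⟨w, hw⟩ := h
    obtain ⟨w, s, rfl⟩ := IsLocalization.exists_mk'_eq m.primeCompl w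
    refine ⟨s, s.2, w, hinj ?_⟩
    rw [map_mul, map_mul, hw, ← IsLocalization.mk'_spec L w s]
    ring
  obtain ⟨t', ht', htq⟩ := hdiv (by rw [map_mul]; exact (hmem _).2 dvd_rfl :
    algebraMap A L b ∣ algebraMap A L (a * q₀))
  obtain ⟨S, hS⟩ : (Ideal.denominators a b).FG := IsNoetherian.noetherian _
  have hz (z : S) : ∃ s ∉ m, q₀ ∣ s * z := by
    have hz : (z : A) ∈ Ideal.denominators a b := hS ▸ Ideal.subset_span z.2
    exact hdiv ((hmem _).1 (by rw [← map_mul]; exact map_dvd _ (Ideal.mem_denominators.1 hz)))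
  choose s hs hsq using hz
  -- The factor t' makes q₀ a denominator over A and not only over the localization. The product
  -- over finitely many generators of the ideal of denominators gives one s for all z.
  refine ⟨t' * q₀, t' * ∏ z, s z, ?_, ?_, fun z hzb ↦ ?_⟩
  · exact m.primeCompl.mul_mem ht' (Submonoid.prod_mem _ fun z _ ↦ hs z)
  · rwa [mul_left_comm]
  · rw [_root_.mul_assoc]
    refine mul_dvd_mul_left _ ?_
    have h1 : Ideal.span (S : Set A) ≤ Ideal.denominators (∏ z, s z) q₀ := by
      rw [Ideal.span_le]
      intro z hz
      refine (hsq ⟨z, hz⟩).trans (mul_dvd_mul_right ?_ _)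
      exact Finset.dvd_prod_of_mem s (Finset.mem_univ _)
    rw [show Ideal.span (S : Set A) = _ from hS] at h1
    exact h1 hzb

namespace RelInv
noncomputable section

/-! ### Restriction, pull-back and germs of regular functions -/

/-- The germ of a regular function at a point. -/
abbrev germAt {X : Scheme.{0}} {U : X.Opens} (s : Γ(X, U)) (x : X) (hx : x ∈ U) :
    X.presheaf.stalk x :=
  (X.presheaf.germ U x hx).hom s

theorem res_res {X : Scheme.{0}} {U V W : X.Opens} (s : Γ(X, U)) (h : V ≤ U) (h' : W ≤ V) :
    res (res s V h) W h' = res s W (h'.trans h) := by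
  simp only [res, ← CommRingCat.comp_apply, ← Functor.map_comp]
  rfl

theorem res_pull {X Y : Scheme.{0}} (f : X ⟶ Y) {V : Y.Opens} (s : Γ(Y, V)) {W W' : X.Opens}
    (h : W ≤ f ⁻¹ᵁ V) (h' : W' ≤ W) : res (pull f s W h) W' h' = pull f s W' (h'.trans h) := by
  rw [res, pull, ← CommRingCat.comp_apply, Scheme.Hom.appLE_map]

theorem pull_res {X Y : Scheme.{0}} (f : X ⟶ Y) {V V' : Y.Opens} (s : Γ(Y, V)) (hV : V' ≤ V)
    {W : X.Opens} (h : W ≤ f ⁻¹ᵁ V') :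
    pull f (res s V' hV) W h = pull f s W (h.trans (f.preimage_mono hV)) := by
  rw [res, pull, ← CommRingCat.comp_apply, Scheme.Hom.map_appLE]

theorem pull_pull {X Y Z : Scheme.{0}} (f : X ⟶ Y) (g : Y ⟶ Z) {V : Z.Opens} (s : Γ(Z, V))
    {U : Y.Opens} (hU : U ≤ g ⁻¹ᵁ V) {W : X.Opens} (h : W ≤ f ⁻¹ᵁ U) :
    pull f (pull g s U hU) W h = pull (f ≫ g) s W (h.trans (f.preimage_mono hU)) := by
  rw [pull, pull, ← CommRingCat.comp_apply, Scheme.Hom.appLE_comp_appLE]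

theorem pull_congr {X Y : Scheme.{0}} {f g : X ⟶ Y} (e : f = g) {V : Y.Opens} (s : Γ(Y, V))
    {W : X.Opens} (h : W ≤ f ⁻¹ᵁ V) : pull f s W h = pull g s W (e ▸ h) := by
  subst e; rfl

theorem pull_id {X : Scheme.{0}} {V : X.Opens} (s : Γ(X, V)) {W : X.Opens} (h : W ≤ 𝟙 X ⁻¹ᵁ V) :
    pull (𝟙 X) s W h = res s W h := by
  have : (𝟙 X : X ⟶ X).appLE V W h = X.presheaf.map (homOfLE h).op := by
    rw [Scheme.Hom.appLE]
    exact Category.id_comp _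
  exact congrArg (fun z ↦ z.hom s) this

theorem germAt_res {X : Scheme.{0}} {U V : X.Opens} (s : Γ(X, U)) (h : V ≤ U) {x : X} (hx : x ∈ V) :
    germAt (res s V h) x hx = germAt s x (h hx) := by
  rw [germAt, res, ← CommRingCat.comp_apply, TopCat.Presheaf.germ_res]

theorem germAt_pull {X Y : Scheme.{0}} (f : X ⟶ Y) {V : Y.Opens} (s : Γ(Y, V)) {W : X.Opens}
    (h : W ≤ f ⁻¹ᵁ V) {x : X} (hx : x ∈ W) :
    germAt (pull f s W h) x hx = (f.stalkMap x).hom (germAt s (f x) (h hx)) := by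
  have h1 : f.appLE V W h ≫ X.presheaf.germ W x hx =
      Y.presheaf.germ V (f x) (h hx) ≫ f.stalkMap x := by
    refine Eq.trans ?_ (f.germ_stalkMap V x (h hx)).symm
    rw [Scheme.Hom.appLE, Category.assoc, TopCat.Presheaf.germ_res]
  exact congrArg (fun z ↦ z.hom s) h1

theorem exists_germAt_eq {X : Scheme.{0}} {x : X} (z : X.presheaf.stalk x) :
    ∃ (V : X.Opens) (hx : x ∈ V) (s : Γ(X, V)), germAt s x hx = z :=
  TopCat.Presheaf.exists_germ_eq X.presheaf z

theorem exists_res_eq_of_germAt_eq {X : Scheme.{0}} {U V : X.Opens} {s : Γ(X, U)} {t : Γ(X, V)}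
    {x : X} {hU : x ∈ U} {hV : x ∈ V} (h : germAt s x hU = germAt t x hV) :
    ∃ (W : X.Opens) (_ : x ∈ W) (hWU : W ≤ U) (hWV : W ≤ V), res s W hWU = res t W hWV := by
  obtain ⟨W, hxW, i, j, e⟩ := TopCat.Presheaf.germ_eq X.presheaf _ _ _ _ _ h
  exact ⟨W, hxW, i.le, j.le, e⟩

theorem exists_gluing {X : Scheme.{0}} {κ : Type} (V : κ → X.Opens) {U : X.Opens}
    (hV : ∀ i, V i ≤ U) (hU : U ≤ ⨆ i, V i) (c : ∀ i, Γ(X, V i))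
    (hc : ∀ i j, res (c i) (V i ⊓ V j) inf_le_left = res (c j) (V i ⊓ V j) inf_le_right) :
    ∃ r : Γ(X, U), ∀ i, res r (V i) (hV i) = c i :=
  (TopCat.Sheaf.existsUnique_gluing' X.sheaf V U (fun i ↦ homOfLE (hV i)) hU c hc).exists

theorem ext_germAt {X : Scheme.{0}} {U : X.Opens} {s t : Γ(X, U)}
    (h : ∀ x hx, germAt s x hx = germAt t x hx) : s = t :=
  TopCat.Presheaf.section_ext X.sheaf U s t h

theorem res_mul {X : Scheme.{0}} {U V : X.Opens} (s t : Γ(X, U)) (h : V ≤ U) :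
    res (s * t) V h = res s V h * res t V h :=
  map_mul _ s t

theorem pull_mul {X Y : Scheme.{0}} (f : X ⟶ Y) {V : Y.Opens} (s t : Γ(Y, V)) {W : X.Opens}
    (h : W ≤ f ⁻¹ᵁ V) : pull f (s * t) W h = pull f s W h * pull f t W h :=
  map_mul _ s t

theorem germAt_mul {X : Scheme.{0}} {U : X.Opens} (s t : Γ(X, U)) (x : X) (hx : x ∈ U) :
    germAt (s * t) x hx = germAt s x hx * germAt t x hx :=
  map_mul _ s t

/-! ### Non-zero-divisors and coprimality under flat pull-back -/

/-- The germs of `s` are non-zero-divisors. -/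
def NonZeroDivisor {X : Scheme.{0}} {U : X.Opens} (s : Γ(X, U)) : Prop :=
  ∀ x hx, ∀ c : X.presheaf.stalk x, germAt s x hx * c = 0 → c = 0

namespace NonZeroDivisor

variable {X : Scheme.{0}} {U V : X.Opens} {s t t' : Γ(X, U)}

theorem restrict (hs : NonZeroDivisor s) (h : V ≤ U) : NonZeroDivisor (res s V h) :=
  fun x hx c hc ↦ hs x (h hx) c (by rwa [germAt_res] at hc)

theorem mul (hs : NonZeroDivisor s) (ht : NonZeroDivisor t) : NonZeroDivisor (s * t) :=
  fun x hx c hc ↦ ht x hx c (hs x hx _ (by rwa [germAt_mul, _root_.mul_assoc] at hc))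

theorem mul_left_cancel (hs : NonZeroDivisor s) (h : s * t = s * t') : t = t' := by
  refine ext_germAt fun x hx ↦ sub_eq_zero.1 (hs x hx _ ?_)
  rw [mul_sub, ← germAt_mul, ← germAt_mul, h, sub_self]

theorem mul_right_cancel (hs : NonZeroDivisor s) (h : t * s = t' * s) : t = t' :=
  hs.mul_left_cancel (by rwa [mul_comm s, mul_comm s])

/-- A regular function which is divisible by a non-zero-divisor locally is divisible globally. -/
theorem dvd_of_germAt (hs : NonZeroDivisor s) (h : ∀ x hx, germAt s x hx ∣ germAt t x hx) :
    s ∣ t := by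
  have key (x : U) : ∃ (V : X.Opens) (_ : x.1 ∈ V) (hV : V ≤ U) (c : Γ(X, V)),
      res s V hV * c = res t V hV := by
    obtain ⟨c, hc⟩ := h x.1 x.2
    obtain ⟨V, hxV, c, rfl⟩ := exists_germAt_eq c
    have hx : x.1 ∈ V ⊓ U := ⟨hxV, x.2⟩
    have h1 : germAt t x.1 x.2 =
        germAt (res s (V ⊓ U) inf_le_right * res c (V ⊓ U) inf_le_left) x.1 hx := by
      rw [germAt_mul, germAt_res, germAt_res, hc]
    obtain ⟨W, hxW, i, j, e⟩ := exists_res_eq_of_germAt_eq h1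
    refine ⟨W, hxW, i, res c W (j.trans inf_le_left), ?_⟩
    rw [res_mul, res_res, res_res] at e
    exact e.symm
  choose V hxV hV c hc using key
  obtain ⟨r, hr⟩ := exists_gluing V hV
    (fun x hx ↦ TopologicalSpace.Opens.mem_iSup.2 ⟨⟨x, hx⟩, hxV ⟨x, hx⟩⟩) c (by
      intro x y
      refine (hs.restrict (inf_le_left.trans (hV x) : V x ⊓ V y ≤ U)).mul_left_cancel ?_
      have h1 := congrArg (fun z ↦ res z (V x ⊓ V y) inf_le_left) (hc x)
      have h2 := congrArg (fun z ↦ res z (V x ⊓ V y) inf_le_right) (hc y)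
      simp only [res_mul, res_res] at h1 h2
      rw [h1, h2])
  refine ⟨r, ext_germAt fun x hx ↦ ?_⟩
  have h1 := congrArg (fun z ↦ germAt z x (hxV ⟨x, hx⟩)) (hc ⟨x, hx⟩)
  rw [← hr] at h1
  simp only [germAt_mul, germAt_res] at h1
  rw [germAt_mul, ← h1]

/-- Regular functions which agree where a non-zero-divisor is invertible are equal. -/
theorem eq_of_res_basicOpen (hs : NonZeroDivisor s) (hV : X.basicOpen s ≤ V) (hVU : V ≤ U)
    (h : res t V hVU = res t' V hVU) : t = t' := by
  refine ext_germAt fun x hx ↦ sub_eq_zero.1 ?_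
  obtain ⟨_, ⟨B, hB, rfl⟩, hxA, hBU⟩ := X.isBasis_affineOpens.exists_subset_of_mem_open hx U.2
  replace hBU : B ≤ U := hBU
  replace hxA : x ∈ B := hxA
  have h1 : res (res t B hBU - res t' B hBU) (X.basicOpen (res s B hBU))
      (X.basicOpen_le _) = 0 := by
    have h2 : X.basicOpen (res s B hBU) ≤ V := by
      refine le_trans ?_ hV
      have : X.basicOpen (res s B hBU) = B ⊓ X.basicOpen s := X.basicOpen_res s (homOfLE hBU).op
      rw [this]
      exact inf_le_right
    have h3 := congrArg (fun z ↦ res z _ h2) h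
    simp only [res_res] at h3
    have h4 : ∀ (a b : Γ(X, B)) (W : X.Opens) (hW : W ≤ B), res (a - b) W hW =
      res a W hW - res b W hW := fun a b W hW ↦ map_sub _ a b
    rw [h4, res_res, res_res, h3, sub_self]
  -- On an affine open set a function that vanishes where s is invertible is killed by a power of s.
  obtain ⟨n, hn⟩ := exists_pow_mul_eq_zero_of_res_basicOpen_eq_zero_of_isCompact X
    (U := B) (IsAffineOpen.isCompact hB) _ _ h1
  have h4 : ∀ n : ℕ, ∀ c : X.presheaf.stalk x, germAt s x hx ^ n * c = 0 → c = 0 := by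
    intro n
    induction n with
    | zero => intro c; simp
    | succ n ih =>
      intro c hc
      rw [pow_succ, _root_.mul_assoc] at hc
      exact hs x hx c (ih _ hc)
  apply h4 n
  have h5 := (congrArg (fun z ↦ germAt z x hxA) hn).trans
    (map_zero (X.presheaf.germ B x hxA).hom)
  simp only [germAt_mul] at h5
  rw [germAt, germAt, map_pow, map_sub, ← germAt, ← germAt] at h5
  simpa only [germAt_res] using h5

/-- The pull-back of a non-zero-divisor by a flat morphism. -/
theorem pull {Y : Scheme.{0}} {f : X ⟶ Y} [Flat f] {V : Y.Opens} {s : Γ(Y, V)}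
    (hs : NonZeroDivisor s) (W : X.Opens) (h : W ≤ f ⁻¹ᵁ V) : NonZeroDivisor (pull f s W h) := by
  intro x hx c hc
  rw [germAt_pull] at hc
  algebraize [(f.stalkMap x).hom]
  have : Module.Flat (Y.presheaf.stalk (f x)) (X.presheaf.stalk x) := Flat.stalkMap f x
  -- With b = w = 0 the criterion writes c as a combination of elements of the lower stalk killed by
  -- the germ of s.
  obtain ⟨n, a, d, y, had, rfl⟩ := Module.Flat.exists_of_mul_eq_mul (b := 0) (w := 0)
    (hc.trans (by simp))
  refine Finset.sum_eq_zero fun i _ ↦ ?_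
  rw [hs _ (h hx) (a i) (by rw [had i, zero_mul]), map_zero, zero_mul]

end NonZeroDivisor

/-- The germs of `t` are non-zero-divisors modulo the germs of `s`. -/
def CoprimeGerms {X : Scheme.{0}} {U : X.Opens} (s t : Γ(X, U)) : Prop :=
  ∀ x hx, ∀ c : X.presheaf.stalk x, germAt s x hx ∣ germAt t x hx * c → germAt s x hx ∣ c

namespace CoprimeGerms

variable {X : Scheme.{0}} {U V : X.Opens} {s t c : Γ(X, U)}

theorem restrict (h : CoprimeGerms s t) (hV : V ≤ U) :
    CoprimeGerms (res s V hV) (res t V hV) := fun x hx c hc ↦ by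
  rw [germAt_res] at hc ⊢
  rw [germAt_res] at hc
  exact h x (hV hx) c hc

/-- By flatness a solution of t c = s w upstairs is a combination of solutions in the stalk of Y,
and s divides each of those. -/
theorem pull {Y : Scheme.{0}} {f : X ⟶ Y} [Flat f] {V : Y.Opens} {s t : Γ(Y, V)}
    (hst : CoprimeGerms s t) (W : X.Opens) (h : W ≤ f ⁻¹ᵁ V) :
    CoprimeGerms (pull f s W h) (pull f t W h) := by
  intro x hx c ⟨w, hw⟩
  rw [germAt_pull, germAt_pull] at hw
  rw [germAt_pull]
  algebraize [(f.stalkMap x).hom]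
  have : Module.Flat (Y.presheaf.stalk (f x)) (X.presheaf.stalk x) := Flat.stalkMap f x
  obtain ⟨n, a, d, y, had, rfl⟩ := Module.Flat.exists_of_mul_eq_mul hw
  refine Finset.dvd_sum fun i _ ↦ Dvd.dvd.mul_right ?_ _
  exact map_dvd (f.stalkMap x).hom (hst _ (h hx) (a i) ⟨d i, had i⟩)

theorem dvd_of_dvd_mul (h : CoprimeGerms s t) (hs : NonZeroDivisor s) (hc : s ∣ t * c) : s ∣ c := by
  refine hs.dvd_of_germAt fun x hx ↦ h x hx _ ?_
  rw [← germAt_mul]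
  obtain ⟨w, hw⟩ := hc
  exact ⟨germAt w x hx, by rw [hw, germAt_mul]⟩

end CoprimeGerms

section FunctionField

variable {X : Scheme.{0}} [IsIntegral X] {U V : X.Opens}

theorem toRat_injective [Nonempty U] : Function.Injective (toRat : Γ(X, U) → X.functionField) :=
  Scheme.germToFunctionField_injective X U

theorem toRat_mul [Nonempty U] (s t : Γ(X, U)) : toRat (s * t) = toRat s * toRat t :=
  map_mul _ s t

theorem toRat_add [Nonempty U] (s t : Γ(X, U)) : toRat (s + t) = toRat s + toRat t :=
  map_add _ s t

theorem toRat_sub [Nonempty U] (s t : Γ(X, U)) : toRat (s - t) = toRat s - toRat t :=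
  map_sub _ s t

theorem toRat_one [Nonempty U] : toRat (1 : Γ(X, U)) = 1 :=
  map_one _

theorem toRat_res [Nonempty U] [Nonempty V] (s : Γ(X, U)) (h : V ≤ U) :
    toRat (res s V h) = toRat s :=
  germAt_res s h _

instance nonempty_inf [hU : Nonempty U] [hV : Nonempty V] : Nonempty (U ⊓ V : X.Opens) := by
  obtain ⟨x, hx⟩ := nonempty_preirreducible_inter U.2 V.2
    (Set.nonempty_coe_sort.1 hU) (Set.nonempty_coe_sort.1 hV)
  exact ⟨⟨x, hx⟩⟩

/-- Equality of regular functions on an integral scheme can be checked in the function field. -/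
theorem ext_toRat {s t : Γ(X, U)} (h : ∀ [Nonempty U], toRat s = toRat t) : s = t := by
  by_cases hU : Nonempty U
  · exact toRat_injective h
  · exact ext_germAt fun x hx ↦ (hU ⟨⟨x, hx⟩⟩).elim

/-- The image in the function field of the germ of a regular function. -/
theorem stalk_toRat [Nonempty U] (s : Γ(X, U)) {x : X} (hx : x ∈ U) :
    algebraMap (X.presheaf.stalk x) X.functionField (germAt s x hx) = toRat s :=
  Scheme.algebraMap_germ_eq_germToFunctionField X hx s

theorem nonZeroDivisor_of_toRat_ne_zero [Nonempty U] {s : Γ(X, U)} (hs : toRat s ≠ 0) :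
    NonZeroDivisor s := fun x hx c hc ↦ by
  have h1 : germAt s x hx ≠ 0 := fun h ↦ hs (by rw [← stalk_toRat s hx, h, map_zero])
  exact (mul_eq_zero.1 hc).resolve_left h1

end FunctionField

/-! ### Local fractions in lowest terms on a smooth variety -/

section Chart

/-- An open set `U` with a presentation `p / q` of a rational function as a fraction in lowest
terms. -/
structure Chart {X : Scheme.{0}} [IsIntegral X] (R : X.functionField) where
  U : X.Opens
  nonempty : Nonempty U
  p : Γ(X, U)
  q : Γ(X, U)
  q_ne_zero : toRat q ≠ 0
  eq : toRat p = R * toRat q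
  coprime : CoprimeGerms q p

/-- The chart is the locus where s is invertible. Stalk elements there are fractions over Γ(X, V),
so q ∣ p c clears to b ∣ a z with z a multiple of c by units; then q ∣ s z, and s is a unit. -/
theorem exists_chart_aux {X : Scheme.{0}} [IsIntegral X] (R : X.functionField) {V : X.Opens}
    (hV : IsAffineOpen V) [Nonempty V]
    (h : ∀ (m : Ideal Γ(X, V)) [m.IsMaximal] (a b : Γ(X, V)), b ≠ 0 →
      ∃ q s, s ∉ m ∧ b ∣ a * q ∧ ∀ z, b ∣ a * z → q ∣ s * z) {x : X} (hx : x ∈ V) :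
    ∃ c : Chart R, x ∈ c.U ∧ c.U ≤ V := by
  have := functionField_isFractionRing_of_isAffineOpen X V hV
  obtain ⟨a, b, hb, hR⟩ := IsFractionRing.div_surjective (A := Γ(X, V)) R
  have hb0 : b ≠ 0 := nonZeroDivisors.ne_zero hb
  have hRb : toRat a = R * toRat b := by
    rw [← hR]
    exact (div_mul_cancel₀ _ (by
      rw [Ne, map_eq_zero_iff _ (IsFractionRing.injective Γ(X, V) X.functionField)]
      exact hb0)).symm
  -- The point x need not be closed; s ∉ m for a maximal ideal m above its prime still makes s
  -- invertible at x.
  obtain ⟨m, hm, hxm⟩ := Ideal.exists_le_maximal _ (hV.primeIdealOf ⟨x, hx⟩).isPrime.ne_top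
  obtain ⟨q, s, hs, ⟨p, hp⟩, hq⟩ := h m a b hb0
  have hunit {y : X} (hy : y ∈ V) (f : Γ(X, V)) :
      IsUnit (germAt f y hy) ↔ f ∈ (hV.primeIdealOf ⟨y, hy⟩).asIdeal.primeCompl :=
    let := X.presheaf.algebra_section_stalk ⟨y, hy⟩
    have := hV.isLocalization_stalk ⟨y, hy⟩
    IsLocalization.AtPrime.isUnit_to_map_iff (X.presheaf.stalk y) _ f
  have hfrac {y : X} (hy : y ∈ V) (c : X.presheaf.stalk y) : ∃ c₀ t : Γ(X, V),
      IsUnit (germAt t y hy) ∧ c * germAt t y hy = germAt c₀ y hy := by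
    let := X.presheaf.algebra_section_stalk ⟨y, hy⟩
    have := hV.isLocalization_stalk ⟨y, hy⟩
    obtain ⟨⟨c₀, t⟩, hc⟩ := IsLocalization.surj (hV.primeIdealOf ⟨y, hy⟩).asIdeal.primeCompl c
    exact ⟨c₀, t, (hunit hy t).2 t.2, hc⟩
  have hxs : x ∈ X.basicOpen s := by
    rw [Scheme.mem_basicOpen X s x hx]
    exact (hunit hx s).2 fun h ↦ hs (hxm h)
  have hs0 : s ≠ 0 := fun h ↦ hs (h ▸ zero_mem m)
  have hq0 : q ≠ 0 := by
    rintro rfl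
    have := zero_dvd_iff.1 (hq b (dvd_mul_left b a))
    exact (mul_eq_zero.1 this).elim hs0 hb0
  have hne : Nonempty (X.basicOpen s) := ⟨⟨x, hxs⟩⟩
  have hqr : toRat q ≠ 0 := fun h ↦ hq0 (toRat_injective (h.trans (map_zero _).symm))
  have hbr : toRat b ≠ 0 := fun h ↦ hb0 (toRat_injective (h.trans (map_zero _).symm))
  have hle := X.basicOpen_le s
  refine ⟨⟨X.basicOpen s, hne, res p _ hle, res q _ hle, by rwa [toRat_res], ?_, ?_⟩, hxs, hle⟩
  · rw [toRat_res, toRat_res]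
    refine mul_left_cancel₀ hbr ?_
    rw [← toRat_mul, ← hp, toRat_mul, hRb]
    ring
  · rintro y hy c ⟨d, hd⟩
    rw [germAt_res, germAt_res] at hd
    rw [germAt_res]
    have hyV := hle hy
    have hsy : IsUnit (germAt s y hyV) := (Scheme.mem_basicOpen X s y hyV).1 hy
    obtain ⟨c₀, t₀, ht₀, hc⟩ := hfrac hyV c
    obtain ⟨d₀, t₁, ht₁, hd'⟩ := hfrac hyV d
    have h1 : p * c₀ * t₁ = q * d₀ * t₀ := by
      refine germ_injective_of_isIntegral X y hyV ?_
      change germAt (p * c₀ * t₁) y hyV = germAt (q * d₀ * t₀) y hyV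
      simp only [germAt_mul]
      rw [← hc, ← hd']
      linear_combination germAt t₀ y hyV * germAt t₁ y hyV * hd
    have h2 : b ∣ a * (c₀ * t₁) := by
      refine ⟨d₀ * t₀, mul_left_cancel₀ hq0 ?_⟩
      linear_combination b * h1 + c₀ * t₁ * hp
    obtain ⟨w, hw⟩ := hq _ h2
    have h3 := congrArg (fun z ↦ germAt z y hyV) hw
    simp only [germAt_mul] at h3
    rw [← hc] at h3
    have h4 : germAt q y hyV ∣ germAt s y hyV * (c * germAt t₀ y hyV * germAt t₁ y hyV) := ⟨_, h3⟩
    rwa [hsy.dvd_mul_left, ht₁.dvd_mul_right, ht₀.dvd_mul_right] at h4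

theorem exists_chart (M : CScheme) [IsIntegral M.left] [Smooth M.hom] (R : M.left.functionField)
    {U : M.left.Opens} {x : M.left} (hx : x ∈ U) : ∃ c : Chart R, x ∈ c.U ∧ c.U ≤ U := by
  obtain ⟨_, ⟨V, hV, rfl⟩, hxV, hVU⟩ :=
    M.left.isBasis_affineOpens.exists_subset_of_mem_open hx U.2
  have : Nonempty V := ⟨⟨x, hxV⟩⟩
  obtain ⟨c, hc, hcV⟩ := exists_chart_aux R hV (x := x) (fun m _ a b hb ↦ by
    let φ : ℂ →+* Γ(M.left, V) := (M.hom.appLE ⊤ V le_top).hom.comp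
      (Scheme.ΓSpecIso (CommRingCat.of ℂ)).inv.hom
    have h1 : (M.hom.appLE ⊤ V le_top).hom.Smooth :=
      HasRingHomProperty.appLE @Smooth M.hom inferInstance ⟨⊤, isAffineOpen_top _⟩ ⟨V, hV⟩ le_top
    have h2 : φ.Smooth := RingHom.Smooth.comp
      (RingHom.Smooth.of_bijective
      (ConcreteCategory.bijective_of_isIso (Scheme.ΓSpecIso (CommRingCat.of ℂ)).inv)) h1
    algebraize [φ]
    exact Ideal.exists_reduced_denominator ℂ m a hb) hxV
  exact ⟨c, hc, hcV.trans hVU⟩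

end Chart
-- The action, the projection and the involution exchanging them
section Categorical

variable {C : Type*} [Category C] [CartesianMonoidalCategory C] (G M : C) [GrpObj G] [ModObj G M]

/-- The action morphism. -/
abbrev smulHom : G ⊗ M ⟶ M := ModObj.smul (M := G) (X := M)

variable {G M} {T : C}

theorem lift_mul_smulHom (a b : T ⟶ G) (x : T ⟶ M) :
    lift (lift a b ≫ μ[G]) x ≫ smulHom G M = lift a (lift b x ≫ smulHom G M) ≫ smulHom G M := by
  have h1 : lift (lift a b ≫ μ[G]) x = lift (lift a b) x ≫ μ[G] ▷ M := by simp
  have h2 : lift (lift a b) x ≫ (α_ G G M).hom ≫ G ◁ smulHom G M =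
    lift a (lift b x ≫ smulHom G M) := by simp
  rw [h1, ← h2, Category.assoc, Category.assoc, Category.assoc, ModObj.mul_smul_self]

theorem lift_one_smulHom (x : T ⟶ M) : lift (toUnit T ≫ η[G]) x ≫ smulHom G M = x := by
  have h1 : lift (toUnit T ≫ η[G]) x = lift (toUnit T) x ≫ η[G] ▷ M := by simp
  rw [h1, Category.assoc, ModObj.one_smul_self]
  simp

variable (G M)

/-- The involution `(g, x) ↦ (g⁻¹, g x)`. -/
def flipHom : G ⊗ M ⟶ G ⊗ M := lift (fst G M ≫ ι[G]) (smulHom G M)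

theorem flipHom_snd : flipHom G M ≫ snd G M = smulHom G M := by simp [flipHom]

theorem flipHom_smulHom : flipHom G M ≫ smulHom G M = snd G M := by
  have h1 : smulHom G M = lift (fst G M) (snd G M) ≫ smulHom G M := by simp
  have h2 := lift_mul_smulHom (fst G M ≫ ι[G]) (fst G M) (snd G M)
  rw [← h1, GrpObj.lift_comp_inv_left, lift_one_smulHom] at h2
  exact h2.symm

theorem flipHom_flipHom : flipHom G M ≫ flipHom G M = 𝟙 (G ⊗ M) := by
  apply CartesianMonoidalCategory.hom_ext
  · rw [Category.assoc]
    simp [flipHom]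
  · rw [Category.assoc, flipHom_snd, flipHom_smulHom, Category.id_comp]

end Categorical

section Action

variable (G M : CScheme) [GrpObj G]

theorem oneMap_proj : oneMap G M ≫ proj G M = 𝟙 _ :=
  congrArg Over.Hom.left (by simp : ((λ_ M).inv ≫ η[G] ▷ M) ≫ snd G M = 𝟙 M)

theorem mulMap_proj : mulMap G M ≫ proj G M = projMap G M ≫ proj G M :=
  congrArg Over.Hom.left
    (by simp : ((α_ G G M).inv ≫ μ[G] ▷ M) ≫ snd G M = snd G (G ⊗ M) ≫ snd G M)

variable [ModObj G M]

/-- `(g, x) ↦ (g⁻¹, g x)`. -/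
def flip : (G ⊗ M).left ⟶ (G ⊗ M).left := (flipHom G M).left

theorem flip_proj : flip G M ≫ proj G M = act G M := congrArg Over.Hom.left (flipHom_snd G M)

theorem flip_act : flip G M ≫ act G M = proj G M := congrArg Over.Hom.left (flipHom_smulHom G M)

theorem flip_flip : flip G M ≫ flip G M = 𝟙 _ := congrArg Over.Hom.left (flipHom_flipHom G M)

instance : IsIso (flip G M) := ⟨flip G M, flip_flip G M, flip_flip G M⟩

theorem flat_snd_left (N : CScheme) [Flat N.hom] : Flat (snd N M).left :=
  inferInstanceAs (Flat (Limits.pullback.snd N.hom M.hom))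

instance flat_proj [Flat G.hom] : Flat (proj G M) := flat_snd_left M G

/-- The action is the projection preceded by an automorphism of G × M. -/
instance flat_act [Flat G.hom] : Flat (act G M) := by
  rw [← flip_proj]
  infer_instance

theorem oneMap_act : oneMap G M ≫ act G M = 𝟙 _ := by
  refine congrArg Over.Hom.left (?_ : ((λ_ M).inv ≫ η[G] ▷ M) ≫ smulHom G M = 𝟙 M)
  rw [Category.assoc, ModObj.one_smul_self, Iso.inv_hom_id]

theorem mulMap_act : mulMap G M ≫ act G M = actMap G M ≫ act G M := by
  refine congrArg Over.Hom.left
    (?_ : ((α_ G G M).inv ≫ μ[G] ▷ M) ≫ smulHom G M = (G ◁ smulHom G M) ≫ smulHom G M)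
  rw [Category.assoc, ModObj.mul_smul_self, Iso.inv_hom_id_assoc]

theorem actMap_proj : actMap G M ≫ proj G M = projMap G M ≫ act G M :=
  congrArg Over.Hom.left (by simp : (G ◁ smulHom G M) ≫ snd G M = snd G (G ⊗ M) ≫ smulHom G M)

instance flat_projMap [Flat G.hom] : Flat (projMap G M) := flat_snd_left (G ⊗ M) G

end Action
theorem pull_eq_of_toRat_eq {X Y : Scheme.{0}} [IsIntegral Y] (f : X ⟶ Y) {U V : Y.Opens}
    [Nonempty U] [Nonempty V] {s : Γ(Y, U)} {t : Γ(Y, V)} (h : toRat s = toRat t) {W : X.Opens}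
    (hU : W ≤ f ⁻¹ᵁ U) (hV : W ≤ f ⁻¹ᵁ V) : pull f s W hU = pull f t W hV := by
  have h1 : res s (U ⊓ V) inf_le_left = res t (U ⊓ V) inf_le_right :=
    toRat_injective (by rwa [toRat_res, toRat_res])
  have h2 : W ≤ f ⁻¹ᵁ (U ⊓ V) := le_inf hU hV
  rw [← pull_res f s inf_le_left h2, h1, pull_res]

/-! ### Equivariant line bundles of stable Cartier divisors -/

/-- An effective Cartier divisor on an integral scheme, given by local equations. -/
structure LocalEquations (X : Scheme.{0}) [IsIntegral X] where
  idx : Type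
  U : idx → X.Opens
  nonempty : ∀ i, Nonempty (U i)
  cover : ⨆ i, U i = ⊤
  s : ∀ i, Γ(X, U i)
  s_ne_zero : ∀ i, toRat (s i) ≠ 0
  g : ∀ i j, Γ(X, U i ⊓ U j)
  g_mul_s : ∀ i j, res (s i) (U i ⊓ U j) inf_le_left = g i j * res (s j) (U i ⊓ U j) inf_le_right

attribute [instance] LocalEquations.nonempty

namespace LocalEquations

section LineBundle

variable {X : Scheme.{0}} [IsIntegral X] (D : LocalEquations X)

theorem toRat_g (i j : D.idx) : toRat (D.g i j) * toRat (D.s j) = toRat (D.s i) := by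
  have h := congrArg toRat (D.g_mul_s i j)
  rw [toRat_mul, toRat_res, toRat_res] at h
  exact h.symm

theorem toRat_g_eq (i j : D.idx) : toRat (D.g i j) = toRat (D.s i) / toRat (D.s j) :=
  eq_div_of_mul_eq (D.s_ne_zero j) (D.toRat_g i j)

/-- The line bundle of an effective Cartier divisor. -/
def lineBundle : LineBundle X where
  idx := D.idx
  U := D.U
  nonempty := D.nonempty
  cover := D.cover
  g := D.g
  g_self := fun (i : D.idx) ↦ toRat_injective (by rw [toRat_g_eq, div_self (D.s_ne_zero i), toRat_one])
  g_mul := fun (i j k : D.idx) W hij hjk hik ↦ ext_toRat fun {_} ↦ by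
    rw [toRat_mul, toRat_res, toRat_res, toRat_res, toRat_g_eq, toRat_g_eq, toRat_g_eq,
      div_mul_div_cancel₀ (D.s_ne_zero j)]

/-- The section of the line bundle of a divisor with coordinates `I * s i`. -/
def scaledSection (I : X.functionField) : RationalSection D.lineBundle where
  val := fun (i : D.idx) ↦ I * toRat (D.s i)
  compat := fun (i j : D.idx) W _ (h : W ≤ D.U i ⊓ D.U j) ↦ by
    change _ = toRat (res (D.g i j) W h) * _
    rw [toRat_res, mul_left_comm]
    exact congrArg _ (D.toRat_g i j).symm

/-- The canonical section of the line bundle of a divisor. -/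
def canonicalSection : RationalSection D.lineBundle where
  val := fun (i : D.idx) ↦ toRat (D.s i)
  compat := fun (i j : D.idx) W _ (h : W ≤ D.U i ⊓ D.U j) ↦ by
    change _ = toRat (res (D.g i j) W h) * _
    rw [toRat_res]
    exact (D.toRat_g i j).symm

theorem canonicalSection_isRegular : D.canonicalSection.IsRegular := fun i ↦ ⟨D.s i, rfl⟩

theorem canonicalSection_isNonzero : D.canonicalSection.IsNonzero := D.s_ne_zero

end LineBundle

section Group

variable {G M : CScheme} [GrpObj G] [ModObj G M] [Flat G.hom] [IsIntegral M.left]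
  (D : LocalEquations M.left)
  (Φ : ∀ i j, Γ((G ⊗ M).left, act G M ⁻¹ᵁ D.U i ⊓ proj G M ⁻¹ᵁ D.U j))
  (hΦ : ∀ i j, pull (act G M) (D.s i) _ inf_le_left =
    Φ i j * pull (proj G M) (D.s j) _ inf_le_right)

variable {D Φ} in
include hΦ in
omit [Flat G.hom] in
theorem pull_act_s {i j} {W : (G ⊗ M).left.Opens}
    (h : W ≤ act G M ⁻¹ᵁ D.U i ⊓ proj G M ⁻¹ᵁ D.U j) :
    pull (act G M) (D.s i) W (h.trans inf_le_left) =
      res (Φ i j) W h * pull (proj G M) (D.s j) W (h.trans inf_le_right) := by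
  have h1 := congrArg (fun z ↦ res z W h) (hΦ i j)
  simp only [res_mul, res_pull] at h1
  exact h1

theorem pull_s {X Y : Scheme.{0}} [IsIntegral Y] {D : LocalEquations Y} (f : X ⟶ Y)
    {i j : D.idx} {W : X.Opens}
    (h : W ≤ f ⁻¹ᵁ (D.U i ⊓ D.U j)) :
    pull f (D.s i) W (h.trans (f.preimage_mono inf_le_left)) =
      pull f (D.g i j) W h * pull f (D.s j) W (h.trans (f.preimage_mono inf_le_right)) := by
  have h1 := congrArg (fun z ↦ pull f z W h) (D.g_mul_s i j)
  simp only [pull_mul, pull_res] at h1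
  exact h1

theorem nonZeroDivisor_s (i : D.idx) : NonZeroDivisor (D.s i) :=
  nonZeroDivisor_of_toRat_ne_zero (D.s_ne_zero i)

/-- The action of `G` on the line bundle of a `G`-stable divisor. -/
def linearization : Linearization G M D.lineBundle where
  Φ := Φ
  compat := fun (i i' j j' : D.idx) W (h : W ≤ act G M ⁻¹ᵁ D.U i ⊓ proj G M ⁻¹ᵁ D.U j)
      (h' : W ≤ act G M ⁻¹ᵁ D.U i' ⊓ proj G M ⁻¹ᵁ D.U j')
      (ha : W ≤ act G M ⁻¹ᵁ (D.U i ⊓ D.U i')) (hp : W ≤ proj G M ⁻¹ᵁ (D.U j ⊓ D.U j')) ↦ by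
    have hp2 := hp.trans ((proj G M).preimage_mono inf_le_right)
    -- Each axiom is checked after multiplication by a local equation. It cancels by flatness,
    -- without integrality of G × M.
    refine ((D.nonZeroDivisor_s j').pull (f := proj G M) W hp2).mul_right_cancel ?_
    have h1 := pull_act_s hΦ h
    have h2 := pull_act_s hΦ h'
    have h3 := pull_s (act G M) ha
    have h4 := pull_s (proj G M) hp
    change res (Φ i j) W h * pull (proj G M) (D.g j j') W hp * _ =
      pull (act G M) (D.g i i') W ha * res (Φ i' j') W h' * _
    rw [_root_.mul_assoc, _root_.mul_assoc, ← h4, ← h2, ← h1, ← h3]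
  one := fun (i j : D.idx) W (h : W ≤ D.U i ⊓ D.U j)
      (h' : W ≤ oneMap G M ⁻¹ᵁ (act G M ⁻¹ᵁ D.U i ⊓ proj G M ⁻¹ᵁ D.U j)) ↦ by
    refine ((D.nonZeroDivisor_s j).restrict (h.trans inf_le_right)).mul_right_cancel ?_
    have h1 := congrArg (fun z ↦ pull (oneMap G M) z W h') (hΦ i j)
    simp only [pull_mul, pull_pull] at h1
    rw [pull_congr (oneMap_act G M), pull_congr (oneMap_proj G M), pull_id, pull_id] at h1
    have h2 := congrArg (fun z ↦ res z W h) (D.g_mul_s i j)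
    simp only [res_mul, res_res] at h2
    change pull (oneMap G M) (Φ i j) W h' * _ = res (D.g i j) W h * _
    rw [← h1, ← h2]
  mul := fun (i j k : D.idx) W
      (hm : W ≤ mulMap G M ⁻¹ᵁ (act G M ⁻¹ᵁ D.U i ⊓ proj G M ⁻¹ᵁ D.U k))
      (ha : W ≤ actMap G M ⁻¹ᵁ (act G M ⁻¹ᵁ D.U i ⊓ proj G M ⁻¹ᵁ D.U j))
      (hp : W ≤ projMap G M ⁻¹ᵁ (act G M ⁻¹ᵁ D.U j ⊓ proj G M ⁻¹ᵁ D.U k)) ↦ by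
    have hk : W ≤ (mulMap G M ≫ proj G M) ⁻¹ᵁ D.U k :=
      hm.trans ((mulMap G M).preimage_mono inf_le_right)
    have : Flat (mulMap G M ≫ proj G M) := by rw [mulMap_proj]; infer_instance
    refine ((D.nonZeroDivisor_s k).pull (f := mulMap G M ≫ proj G M) W hk).mul_right_cancel ?_
    have h1 := congrArg (fun z ↦ pull (mulMap G M) z W hm) (hΦ i k)
    have h2 := congrArg (fun z ↦ pull (actMap G M) z W ha) (hΦ i j)
    have h3 := congrArg (fun z ↦ pull (projMap G M) z W hp) (hΦ j k)
    simp only [pull_mul, pull_pull] at h1 h2 h3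
    rw [pull_congr (mulMap_act G M)] at h1
    rw [pull_congr (actMap_proj G M)] at h2
    change pull (mulMap G M) (Φ i k) W hm * _ =
      pull (actMap G M) (Φ i j) W ha * pull (projMap G M) (Φ j k) W hp * _
    rw [← h1, h2, h3, _root_.mul_assoc, pull_congr (mulMap_proj G M)]

theorem isInvariant (R : RationalSection D.lineBundle) (t : ∀ i, Γ(M.left, D.U i))
    (ht : ∀ i, toRat (t i) = R.val i)
    (h : ∀ i j, pull (act G M) (t i) _ inf_le_left =
      Φ i j * pull (proj G M) (t j) _ inf_le_right) :
    R.IsInvariant (D.linearization Φ hΦ) := by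
  intro (i : D.idx) (j : D.idx) V V' _ _ f f' hf hf' W ha hp
    (hW : W ≤ act G M ⁻¹ᵁ D.U i ⊓ proj G M ⁻¹ᵁ D.U j)
  have h1 := congrArg (fun z ↦ res z W hW) (h i j)
  simp only [res_mul, res_pull] at h1
  rw [pull_eq_of_toRat_eq (act G M) (hf.trans (ht i).symm) ha (hW.trans inf_le_left),
    pull_eq_of_toRat_eq (proj G M) (hf'.trans (ht j).symm) hp (hW.trans inf_le_right)]
  exact h1

end Group

section Lie

variable {G M : CScheme} [GrpObj G] [ModObj G M] [IsIntegral M.left]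
  (D : LocalEquations M.left)
  (h : ∀ i (X : lieAlg G M), ∃ l : Γ(M.left, D.U i), toRat l * toRat (D.s i) = X.1 (toRat (D.s i)))

/-- The action of `𝔤` on the line bundle of a `𝔤`-stable divisor. -/
def lieLinearization : LieLinearization G M D.lineBundle where
  lam := fun (i : D.idx) ↦
    -- The logarithmic derivative of the local equation is the only choice that makes the canonical
    -- section invariant.
    { toFun X := X.1 (toRat (D.s i)) / toRat (D.s i)
      map_add' X Y := add_div _ _ _
      map_smul' c X := smul_div_assoc c (X.1 (toRat (D.s i))) _ }
  regular := fun (i : D.idx) X ↦ (h i X).imp fun l hl ↦ eq_div_of_mul_eq (D.s_ne_zero i) hl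
  cocycle := fun (i : D.idx) X Y ↦ by
    have h0 := D.s_ne_zero i
    change (⁅X.1, Y.1⁆ : Derivation ℂ _ _) _ / _ = X.1 (_ / _) - Y.1 (_ / _)
    rw [Derivation.commutator_apply, Derivation.leibniz_div, Derivation.leibniz_div]
    simp only [smul_eq_mul]
    field_simp
    ring
  compat := fun (i j : D.idx) X W _ (hW : W ≤ D.U i ⊓ D.U j) ↦ by
    have h0 := D.s_ne_zero i
    have h1 := D.s_ne_zero j
    change X.1 _ / _ - X.1 _ / _ = X.1 (toRat (res (D.g i j) W hW)) / toRat (res (D.g i j) W hW)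
    rw [toRat_res, toRat_g_eq, Derivation.leibniz_div]
    simp only [smul_eq_mul]
    field_simp

end Lie

end LocalEquations

-- Divisors of numerators and denominators of a rational section

attribute [instance] Chart.nonempty

theorem LineBundle.isUnit_g {X : Scheme.{0}} (L : LineBundle X) (i j : L.idx) {W : X.Opens}
    (h : W ≤ L.U i ⊓ L.U j) : IsUnit (res (L.g i j) W h) := by
  have h' : W ≤ L.U j ⊓ L.U i := le_inf (h.trans inf_le_right) (h.trans inf_le_left)
  have hi : W ≤ L.U i ⊓ L.U i := le_inf (h.trans inf_le_left) (h.trans inf_le_left)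
  refine IsUnit.of_mul_eq_one (res (L.g j i) W h') ?_
  rw [L.g_mul i j i W h h' hi, L.g_self]
  exact map_one _

/-- A presentation of a rational section of a line bundle on an open set as a fraction in lowest
terms. -/
structure LocalFraction {X : Scheme.{0}} [IsIntegral X] {L : LineBundle X}
    (R : RationalSection L) where
  i : L.idx
  chart : Chart (R.val i)
  le : chart.U ≤ L.U i

namespace LocalFraction

section Scheme

variable {X : Scheme.{0}} [IsIntegral X] {L : LineBundle X} {R : RationalSection L}

/-- The domain of a local fraction. -/
abbrev U (a : LocalFraction R) : X.Opens := a.chart.U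

/-- The numerator. -/
abbrev p (a : LocalFraction R) : Γ(X, a.U) := a.chart.p

/-- The denominator. -/
abbrev q (a : LocalFraction R) : Γ(X, a.U) := a.chart.q

theorem nonZeroDivisor_q (a : LocalFraction R) : NonZeroDivisor a.q :=
  nonZeroDivisor_of_toRat_ne_zero a.chart.q_ne_zero

theorem toRat_p (a : LocalFraction R) : toRat a.p = R.val a.i * toRat a.q := a.chart.eq

variable (a b : LocalFraction R)

theorem inf_le : a.U ⊓ b.U ≤ L.U a.i ⊓ L.U b.i := inf_le_inf a.le b.le

theorem cross {W : X.Opens} (ha : W ≤ a.U) (hb : W ≤ b.U) :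
    res a.p W ha * res b.q W hb =
      res (L.g a.i b.i) W ((le_inf ha hb).trans (inf_le a b)) * (res b.p W hb * res a.q W ha) := by
  refine ext_toRat fun {_} ↦ ?_
  simp only [toRat_mul, toRat_res a.p, toRat_res a.q, toRat_res b.p, toRat_res b.q, toRat_p]
  linear_combination toRat a.q * toRat b.q * R.compat a.i b.i W ((le_inf ha hb).trans (inf_le a b))

/-- By `cross`, the denominator of a divides the product of the numerator of a and the denominator
of b; coprimality removes the numerator. By symmetry the denominators differ by a unit, so they glue
to a divisor. -/
theorem q_dvd_q {W : X.Opens} (ha : W ≤ a.U) (hb : W ≤ b.U) : res a.q W ha ∣ res b.q W hb := by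
  refine (a.chart.coprime.restrict ha).dvd_of_dvd_mul (a.nonZeroDivisor_q.restrict ha) ?_
  exact ⟨res (L.g a.i b.i) W ((le_inf ha hb).trans (inf_le a b)) * res b.p W hb, by
    rw [cross a b ha hb]; ring⟩

/-- The ratio of two denominators. -/
def ratio : Γ(X, a.U ⊓ b.U) :=
  (q_dvd_q b a (inf_le_right : a.U ⊓ b.U ≤ _) inf_le_left).choose

theorem res_q : res a.q (a.U ⊓ b.U) inf_le_left = ratio a b * res b.q (a.U ⊓ b.U) inf_le_right := by
  rw [mul_comm]
  exact (q_dvd_q b a (inf_le_right : a.U ⊓ b.U ≤ _) inf_le_left).choose_spec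

/-- The ratio of two numerators. -/
def pRatio : Γ(X, a.U ⊓ b.U) := res (L.g a.i b.i) (a.U ⊓ b.U) (inf_le a b) * ratio a b

theorem res_p :
    res a.p (a.U ⊓ b.U) inf_le_left = pRatio a b * res b.p (a.U ⊓ b.U) inf_le_right := by
  refine ((b.nonZeroDivisor_q).restrict inf_le_right).mul_right_cancel ?_
  rw [cross a b inf_le_left inf_le_right, res_q, pRatio]
  ring

end Scheme

variable {M : CScheme} [IsIntegral M.left] [Smooth M.hom] {L : LineBundle M.left}

theorem iSup_U (R : RationalSection L) : ⨆ a : LocalFraction R, a.U = ⊤ := by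
  refine top_unique fun x _ ↦ ?_
  have hx : x ∈ ⨆ i, L.U i := by rw [L.cover]; trivial
  obtain ⟨i, hi⟩ := TopologicalSpace.Opens.mem_iSup.1 hx
  obtain ⟨c, hc, hle⟩ := exists_chart M (R.val i) hi
  exact TopologicalSpace.Opens.mem_iSup.2 ⟨⟨i, c, hle⟩, hc⟩

/-- The divisor of denominators of a rational section. -/
def denominators (R : RationalSection L) : LocalEquations M.left where
  idx := LocalFraction R
  U a := a.U
  nonempty a := a.chart.nonempty
  cover := iSup_U R
  s a := a.q
  s_ne_zero a := a.chart.q_ne_zero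
  g := ratio
  g_mul_s := res_q

/-- The divisor of numerators of a non-zero rational section. -/
def numerators {R : RationalSection L} (hR : R.IsNonzero) : LocalEquations M.left where
  idx := LocalFraction R
  U a := a.U
  nonempty a := a.chart.nonempty
  cover := iSup_U R
  s a := a.p
  s_ne_zero a := by
    rw [toRat_p]
    exact mul_ne_zero (hR _) a.chart.q_ne_zero
  g := pRatio
  g_mul_s := res_p

variable {R : RationalSection L}

theorem isUnit_ratio (a b : LocalFraction R) {W : M.left.Opens} (h : W ≤ a.U ⊓ b.U) :
    IsUnit (res (ratio a b) W h) :=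
  (denominators R).lineBundle.isUnit_g a b h

/-- The isomorphism `L ⊗ L_Q ≅ L_P` in fibre coordinates. -/
def tensorCoeff (i : L.idx) (a b : LocalFraction R) : Γ(M.left, L.U i ⊓ a.U ⊓ b.U) :=
  -- The coefficient is read off from p_b = R_{b.i} q_b = g_{b.i, i} R_i (q_b / q_a) q_a.
  res (L.g b.i i) (L.U i ⊓ a.U ⊓ b.U)
      (le_inf (inf_le_right.trans b.le) (inf_le_left.trans inf_le_left)) *
    res (ratio b a) (L.U i ⊓ a.U ⊓ b.U)
      (le_inf inf_le_right (inf_le_left.trans inf_le_right))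

omit [Smooth M.hom] in
theorem toRat_tensorCoeff (i : L.idx) (a b : LocalFraction R) {W : M.left.Opens} [Nonempty W]
    (h : W ≤ L.U i ⊓ a.U ⊓ b.U) :
    toRat (res (tensorCoeff i a b) W h) * R.val i * toRat a.q = toRat b.p := by
  have hba : W ≤ b.U ⊓ a.U :=
    h.trans (le_inf inf_le_right (inf_le_left.trans inf_le_right))
  have hbi : W ≤ L.U b.i ⊓ L.U i :=
    h.trans (le_inf (inf_le_right.trans b.le) (inf_le_left.trans inf_le_left))
  have h1 := congrArg (fun z ↦ toRat (res z W hba)) (res_q b a)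
  simp only [res_res, res_mul, toRat_mul, toRat_res b.q, toRat_res a.q] at h1
  have h2 := R.compat b.i i W hbi
  rw [toRat_p, h1, tensorCoeff, res_mul, res_res, res_res, toRat_mul]
  linear_combination (- toRat (res (ratio b a) W hba) * toRat a.q) * h2

variable (hR : R.IsNonzero)

/-- The isomorphism `L ⊗ L_Q ≅ L_P`. -/
def tensorIso : TensorIso L (denominators R).lineBundle (numerators hR).lineBundle where
  c := tensorCoeff
  isUnit := fun i (a b : LocalFraction R) ↦ (L.isUnit_g _ _ _).mul (isUnit_ratio _ _ _)
  compat := fun i i' (a a' b b' : LocalFraction R) W (h : W ≤ L.U i ⊓ a.U ⊓ b.U)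
      (h' : W ≤ L.U i' ⊓ a'.U ⊓ b'.U) hL (hQ : W ≤ a.U ⊓ a'.U) (hP : W ≤ b.U ⊓ b'.U) ↦ by
    refine ext_toRat fun {_} ↦ ?_
    have h1 := toRat_tensorCoeff i a b h
    have h2 := toRat_tensorCoeff i' a' b' h'
    have h3 := R.compat i i' W hL
    have h4 := congrArg (fun z ↦ toRat (res z W hQ)) (res_q a a')
    have h5 := congrArg (fun z ↦ toRat (res z W hP)) (res_p b b')
    simp only [res_res, res_mul, toRat_mul, toRat_res a.q, toRat_res a'.q,
      toRat_res b.p, toRat_res b'.p] at h4 h5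
    rw [toRat_mul, toRat_mul, toRat_mul]
    change toRat (res (tensorCoeff i a b) W h) * toRat (res (L.g i i') W hL) *
      toRat (res (ratio a a') W hQ) =
        toRat (res (pRatio b b') W hP) * toRat (res (tensorCoeff i' a' b') W h')
    -- Multiplied by R_{i'} q_{a'}, both sides equal p_b.
    refine mul_right_cancel₀ (mul_ne_zero (hR i') a'.chart.q_ne_zero) ?_
    rw [h3, h4] at h1
    linear_combination h1 + h5 - toRat (res (pRatio b b') W hP) * h2

theorem tensorIso_mapsTo : (tensorIso hR).MapsTo R (denominators R).canonicalSection
    (numerators hR).canonicalSection :=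
  fun i (a b : LocalFraction R) W _ (h : W ≤ L.U i ⊓ a.U ⊓ b.U) ↦ toRat_tensorCoeff i a b h

end LocalFraction
-- Invariance under the Lie algebra
-- Fundamental fields preserve regular functions by definition, and this property passes to sums,
-- scalar multiples and brackets, hence to the Lie span.
theorem exists_toRat_eq_apply {G M : CScheme} [GrpObj G] [ModObj G M] [IsIntegral M.left]
    (X : lieAlg G M) (U : M.left.Opens) [Nonempty U] (f : Γ(M.left, U)) :
    ∃ f' : Γ(M.left, U), toRat f' = X.1 (toRat f) := by
  obtain ⟨X, hX⟩ := X
  change ∃ f' : Γ(M.left, U), toRat f' = X (toRat f)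
  induction hX using LieSubalgebra.lieSpan_induction generalizing f with
  | mem X hX =>
    obtain ⟨v, -, hv⟩ := hX
    obtain ⟨f', hf', -⟩ := hv U f
    exact ⟨f', hf'⟩
  | zero => exact ⟨0, map_zero _⟩
  | add X Y _ _ hX hY =>
    obtain ⟨f₁, h₁⟩ := hX f
    obtain ⟨f₂, h₂⟩ := hY f
    exact ⟨f₁ + f₂, by rw [toRat_add, h₁, h₂]; rfl⟩
  | smul c X _ hX =>
    obtain ⟨f₁, h₁⟩ := hX f
    let C : Γ(M.left, U) := res ((M.hom.appTop).hom
      ((Scheme.ΓSpecIso (CommRingCat.of ℂ)).inv.hom c)) U le_top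
    refine ⟨C * f₁, ?_⟩
    have : toRat C = algebraMap ℂ M.left.functionField c :=
      germAt_res _ _ _
    rw [toRat_mul, h₁, this, ← Algebra.smul_def]
    rfl
  | lie X Y _ _ hX hY =>
    obtain ⟨f₁, h₁⟩ := hY f
    obtain ⟨f₂, h₂⟩ := hX f₁
    obtain ⟨f₃, h₃⟩ := hX f
    obtain ⟨f₄, h₄⟩ := hY f₃
    refine ⟨f₂ - f₄, ?_⟩
    rw [toRat_sub, Derivation.commutator_apply, ← h₁, ← h₃, h₂, h₄]

theorem LocalEquations.canonicalSection_isLieInvariant {G M : CScheme} [GrpObj G]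
    [ModObj G M] [IsIntegral M.left] (D : LocalEquations M.left)
    (h : ∀ i (X : lieAlg G M), ∃ l : Γ(M.left, D.U i),
      toRat l * toRat (D.s i) = X.1 (toRat (D.s i))) :
    D.canonicalSection.IsLieInvariant (D.lieLinearization h) :=
  fun i _ ↦ (div_mul_cancel₀ _ (D.s_ne_zero i)).symm

namespace LocalFraction

section Lie

variable {G M : CScheme} [GrpObj G] [ModObj G M] [IsIntegral M.left] {L : LineBundle M.left}
  {R : RationalSection L}

variable {ρ : LieLinearization G M L} (hρ : R.IsLieInvariant ρ)
include hρ

theorem apply_p (a : LocalFraction R) (X : lieAlg G M) :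
    X.1 (toRat a.p) = R.val a.i * X.1 (toRat a.q) + ρ.lam a.i X * toRat a.p := by
  rw [toRat_p, Derivation.leibniz, hρ a.i X]
  simp only [smul_eq_mul]
  ring

/-- Multiplying X(p) = R X(q) + λ p by q gives p X(q) = q (X(p) - λ p); coprimality then yields q ∣
X(q). -/
theorem exists_apply_q (a : LocalFraction R) (X : lieAlg G M) :
    ∃ l : Γ(M.left, a.U), toRat l * toRat a.q = X.1 (toRat a.q) := by
  obtain ⟨p', hp'⟩ := exists_toRat_eq_apply X a.U a.p
  obtain ⟨q', hq'⟩ := exists_toRat_eq_apply X a.U a.q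
  obtain ⟨l', hl'⟩ := ρ.regular a.i X
  have h : a.q ∣ a.p * q' := by
    refine ⟨p' - res l' a.U a.le * a.p, toRat_injective ?_⟩
    rw [toRat_mul, toRat_mul, toRat_sub, toRat_mul, toRat_res, hp', hq', hl', apply_p hρ, toRat_p]
    ring
  obtain ⟨l, hl⟩ := a.chart.coprime.dvd_of_dvd_mul a.nonZeroDivisor_q h
  exact ⟨l, by rw [← hq', hl, toRat_mul, mul_comm]⟩

theorem exists_apply_p (a : LocalFraction R) (X : lieAlg G M) :
    ∃ l : Γ(M.left, a.U), toRat l * toRat a.p = X.1 (toRat a.p) := by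
  obtain ⟨l, hl⟩ := exists_apply_q hρ a X
  obtain ⟨l', hl'⟩ := ρ.regular a.i X
  refine ⟨l + res l' a.U a.le, ?_⟩
  rw [apply_p hρ, ← hl, toRat_add, toRat_res, hl', toRat_p]
  ring

variable [Smooth M.hom]

/-- The action of `𝔤` on the line bundle of the divisor of denominators. -/
def denominatorsLie : LieLinearization G M (denominators R).lineBundle :=
  (denominators R).lieLinearization (exists_apply_q hρ)

/-- The action of `𝔤` on the line bundle of the divisor of numerators. -/
def numeratorsLie (hR : R.IsNonzero) : LieLinearization G M (numerators hR).lineBundle :=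
  (numerators hR).lieLinearization (exists_apply_p hρ)

/-- This is the logarithmic derivative of c R q = p. -/
theorem tensorIso_isLieEquivariant (hR : R.IsNonzero) :
    (tensorIso hR).IsLieEquivariant ρ (denominatorsLie hρ) (numeratorsLie hρ hR) := by
  intro i (a : LocalFraction R) (b : LocalFraction R) X W _ (h : W ≤ L.U i ⊓ a.U ⊓ b.U)
  change X.1 (toRat b.p) / toRat b.p = ρ.lam i X + X.1 (toRat a.q) / toRat a.q +
    X.1 (toRat (res (tensorCoeff i a b) W h)) / toRat (res (tensorCoeff i a b) W h)
  have hc := toRat_tensorCoeff i a b h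
  have hb := (numerators hR).s_ne_zero b
  replace hb : toRat b.p ≠ 0 := hb
  have hq := a.chart.q_ne_zero
  have hi := hR i
  have hX := hρ i X
  generalize toRat (res (tensorCoeff i a b) W h) = c at *
  have hc0 : c ≠ 0 := by
    rintro rfl
    simp at hc
    exact hb hc.symm
  rw [← hc, Derivation.leibniz, Derivation.leibniz, hX]
  simp only [smul_eq_mul]
  field_simp
  ring

end Lie

end LocalFraction
-- Invariance under the group
theorem exists_mul_res_eq {X : Scheme.{0}} {U : X.Opens} (p q : Γ(X, U)) :
    ∃ f : Γ(X, X.basicOpen q),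
      f * res q (X.basicOpen q) (X.basicOpen_le q) = res p (X.basicOpen q) (X.basicOpen_le q) := by
  have h : IsUnit (res q (X.basicOpen q) (X.basicOpen_le q)) :=
    RingedSpace.isUnit_res_basicOpen X.toRingedSpace q
  obtain ⟨u, hu⟩ := h
  exact ⟨res p _ (X.basicOpen_le q) * ↑u⁻¹, by rw [← hu, Units.inv_mul_cancel_right]⟩

theorem basicOpen_pull_le {X Y : Scheme.{0}} (f : X ⟶ Y) {U : Y.Opens} (s : Γ(Y, U)) {W : X.Opens}
    (h : W ≤ f ⁻¹ᵁ U) : X.basicOpen (pull f s W h) ≤ f ⁻¹ᵁ Y.basicOpen s :=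
  (Scheme.basicOpen_appLE f W U h s).le.trans inf_le_right

namespace LocalFraction

section Group

variable {G M : CScheme} [GrpObj G] [ModObj G M] [IsIntegral M.left] [Flat G.hom]
  {L : LineBundle M.left} {R : RationalSection L}

/-- Invariance under G speaks only of regular representatives of R; p / q is one where q is
invertible. -/
theorem exists_fraction (a : LocalFraction R) : ∃ (_ : Nonempty (M.left.basicOpen a.q))
    (f : Γ(M.left, M.left.basicOpen a.q)),
      f * res a.q _ (M.left.basicOpen_le a.q) = res a.p _ (M.left.basicOpen_le a.q) ∧
      toRat f = R.val a.i := by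
  have hne : Nonempty (M.left.basicOpen a.q) := by
    by_contra h
    refine a.chart.q_ne_zero ?_
    have h0 : a.q = 0 := by
      refine (basicOpen_eq_bot_iff a.q).1 (TopologicalSpace.Opens.ext ?_)
      exact Set.eq_empty_of_forall_notMem fun x hx ↦ h ⟨⟨x, hx⟩⟩
    exact (congrArg toRat h0).trans (map_zero _)
  obtain ⟨f, hf⟩ := exists_mul_res_eq a.p a.q
  refine ⟨hne, f, hf, mul_right_cancel₀ a.chart.q_ne_zero ?_⟩
  have h := congrArg toRat hf
  rwa [toRat_mul, toRat_res, toRat_res, toRat_p] at h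

variable {ρ : Linearization G M L} (hρ : R.IsInvariant ρ) (a b : LocalFraction R)
include hρ

/-- This is R(gx) = Φ R(x) with denominators cleared. Invariance gives it where q_a(gx) q_b(x) is
invertible, and it extends to W because that product is a non-zero-divisor. -/
theorem pull_cross {W : (G ⊗ M).left.Opens} (h : W ≤ act G M ⁻¹ᵁ a.U ⊓ proj G M ⁻¹ᵁ b.U)
    (h' : W ≤ act G M ⁻¹ᵁ L.U a.i ⊓ proj G M ⁻¹ᵁ L.U b.i) :
    pull (act G M) a.p W (h.trans inf_le_left) * pull (proj G M) b.q W (h.trans inf_le_right) =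
      res (ρ.Φ a.i b.i) W h' * (pull (proj G M) b.p W (h.trans inf_le_right) *
        pull (act G M) a.q W (h.trans inf_le_left)) := by
  have ha := h.trans inf_le_left
  have hb := h.trans inf_le_right
  obtain ⟨_, f, hf, hfR⟩ := a.exists_fraction
  obtain ⟨_, f', hf', hfR'⟩ := b.exists_fraction
  have hs : NonZeroDivisor (pull (act G M) a.q W ha * pull (proj G M) b.q W hb) :=
    (a.nonZeroDivisor_q.pull _ _).mul (b.nonZeroDivisor_q.pull _ _)
  refine hs.eq_of_res_basicOpen le_rfl ((G ⊗ M).left.basicOpen_le _) ?_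
  set W' := (G ⊗ M).left.basicOpen (pull (act G M) a.q W ha * pull (proj G M) b.q W hb) with hW'
  have hle : W' ≤ W := (G ⊗ M).left.basicOpen_le _
  rw [Scheme.basicOpen_mul] at hW'
  have h1 : W' ≤ act G M ⁻¹ᵁ M.left.basicOpen a.q :=
    hW'.le.trans (inf_le_left.trans (basicOpen_pull_le _ _ _))
  have h2 : W' ≤ proj G M ⁻¹ᵁ M.left.basicOpen b.q :=
    hW'.le.trans (inf_le_right.trans (basicOpen_pull_le _ _ _))
  have h3 := hρ a.i b.i _ _ f f' hfR hfR' W' h1 h2 (hle.trans h')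
  have h4 := congrArg (fun z ↦ pull (act G M) z W' h1) hf
  have h5 := congrArg (fun z ↦ pull (proj G M) z W' h2) hf'
  simp only [pull_mul, pull_res] at h4 h5
  simp only [res_mul, res_pull, res_res]
  rw [← h4, ← h5, h3]
  ring

/-- By `pull_cross`, q_a(gx) divides p_a(gx) q_b(x), and coprimality of q_a and p_a survives
pull-back by the flat action. -/
theorem pull_act_q_dvd {W : (G ⊗ M).left.Opens} (h : W ≤ act G M ⁻¹ᵁ a.U ⊓ proj G M ⁻¹ᵁ b.U) :
    pull (act G M) a.q W (h.trans inf_le_left) ∣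
      pull (proj G M) b.q W (h.trans inf_le_right) := by
  refine (a.chart.coprime.pull W (h.trans inf_le_left)).dvd_of_dvd_mul
    (a.nonZeroDivisor_q.pull _ _) ?_
  have h' : W ≤ act G M ⁻¹ᵁ L.U a.i ⊓ proj G M ⁻¹ᵁ L.U b.i :=
    h.trans (inf_le_inf ((act G M).preimage_mono a.le) ((proj G M).preimage_mono b.le))
  exact ⟨res (ρ.Φ a.i b.i) W h' * pull (proj G M) b.p W (h.trans inf_le_right), by
    rw [pull_cross hρ a b h h']; ring⟩

/-- The substitution (g, x) ↦ (g⁻¹, gx) exchanges action and projection and so turns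
`pull_act_q_dvd` into the converse divisibility. -/
theorem pull_proj_q_dvd {W : (G ⊗ M).left.Opens} (h : W ≤ act G M ⁻¹ᵁ a.U ⊓ proj G M ⁻¹ᵁ b.U) :
    pull (proj G M) b.q W (h.trans inf_le_right) ∣
      pull (act G M) a.q W (h.trans inf_le_left) := by
  have h1 : flip G M ⁻¹ᵁ W ≤ act G M ⁻¹ᵁ b.U ⊓ proj G M ⁻¹ᵁ a.U := by
    refine ((flip G M).preimage_mono h).trans (le_inf ?_ ?_)
    · rw [← flip_proj]
      exact (flip G M).preimage_mono inf_le_right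
    · rw [← flip_act]
      exact (flip G M).preimage_mono inf_le_left
  have h2 : W ≤ flip G M ⁻¹ᵁ (flip G M ⁻¹ᵁ W) := by
    rw [← Scheme.Hom.comp_preimage, flip_flip]
    exact le_rfl
  obtain ⟨c, hc⟩ := pull_act_q_dvd hρ b a h1
  have h3 := congrArg (fun z ↦ pull (flip G M) z W h2) hc
  simp only [pull_mul, pull_pull] at h3
  rw [pull_congr (flip_proj G M), pull_congr (flip_act G M)] at h3
  exact ⟨_, h3⟩

/-- The action on the divisor of denominators in fibre coordinates. -/
def denominatorsΦ : Γ((G ⊗ M).left, act G M ⁻¹ᵁ a.U ⊓ proj G M ⁻¹ᵁ b.U) :=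
  (pull_proj_q_dvd hρ a b le_rfl).choose

theorem pull_act_q : pull (act G M) a.q _ inf_le_left =
    denominatorsΦ hρ a b * pull (proj G M) b.q _ inf_le_right := by
  rw [mul_comm]
  exact (pull_proj_q_dvd hρ a b le_rfl).choose_spec

/-- The action on the divisor of numerators in fibre coordinates. -/
def numeratorsΦ : Γ((G ⊗ M).left, act G M ⁻¹ᵁ a.U ⊓ proj G M ⁻¹ᵁ b.U) :=
  res (ρ.Φ a.i b.i) _
    (inf_le_inf ((act G M).preimage_mono a.le) ((proj G M).preimage_mono b.le)) *
  denominatorsΦ hρ a b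

theorem pull_act_p : pull (act G M) a.p _ inf_le_left =
    numeratorsΦ hρ a b * pull (proj G M) b.p _ inf_le_right := by
  refine (b.nonZeroDivisor_q.pull (f := proj G M) _ inf_le_right).mul_right_cancel ?_
  rw [pull_cross hρ a b le_rfl
    (inf_le_inf ((act G M).preimage_mono a.le) ((proj G M).preimage_mono b.le)),
    pull_act_q hρ a b, numeratorsΦ]
  ring

variable [Smooth M.hom]

/-- The action of `G` on the line bundle of the divisor of denominators. -/
def denominatorsLin : Linearization G M (denominators R).lineBundle :=
  (denominators R).linearization (denominatorsΦ hρ) (pull_act_q hρ)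

/-- The action of `G` on the line bundle of the divisor of numerators. -/
def numeratorsLin (hR : R.IsNonzero) : Linearization G M (numerators hR).lineBundle :=
  (numerators hR).linearization (numeratorsΦ hρ) (pull_act_p hρ)

/-- The coefficient is a transition function of L times one of L_Q, so the claim is the product of
the compatibilities of `ρ` and of `denominatorsLin`. -/
theorem tensorIso_isEquivariant (hR : R.IsNonzero) :
    (tensorIso hR).IsEquivariant ρ (denominatorsLin hρ) (numeratorsLin hρ hR) := by
  intro i i' (a : LocalFraction R) (a' : LocalFraction R) (b : LocalFraction R)
    (b' : LocalFraction R) W (ha : W ≤ act G M ⁻¹ᵁ (L.U i ⊓ a.U ⊓ b.U))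
    (hp : W ≤ proj G M ⁻¹ᵁ (L.U i' ⊓ a'.U ⊓ b'.U)) hA
    (hB : W ≤ act G M ⁻¹ᵁ a.U ⊓ proj G M ⁻¹ᵁ a'.U)
    (hC : W ≤ act G M ⁻¹ᵁ b.U ⊓ proj G M ⁻¹ᵁ b'.U)
  have hba : W ≤ act G M ⁻¹ᵁ (b.U ⊓ a.U) :=
    le_inf (hC.trans inf_le_left) (hB.trans inf_le_left)
  have hba' : W ≤ proj G M ⁻¹ᵁ (b'.U ⊓ a'.U) :=
    le_inf (hC.trans inf_le_right) (hB.trans inf_le_right)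
  have hbi : W ≤ act G M ⁻¹ᵁ (L.U b.i ⊓ L.U i) :=
    le_inf (hC.trans (inf_le_left.trans ((act G M).preimage_mono b.le))) (hA.trans inf_le_left)
  have hbi' : W ≤ proj G M ⁻¹ᵁ (L.U b'.i ⊓ L.U i') :=
    le_inf (hC.trans (inf_le_right.trans ((proj G M).preimage_mono b'.le))) (hA.trans inf_le_right)
  have hbb : W ≤ act G M ⁻¹ᵁ L.U b.i ⊓ proj G M ⁻¹ᵁ L.U b'.i :=
    le_inf (hbi.trans ((act G M).preimage_mono inf_le_left))
      (hbi'.trans ((proj G M).preimage_mono inf_le_left))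
  have h1 := ρ.compat b.i i b'.i i' W hbb hA hbi hbi'
  have h2 : res (denominatorsΦ hρ b b') W hC * pull (proj G M) (ratio b' a') W hba' =
      pull (act G M) (ratio b a) W hba * res (denominatorsΦ hρ a a') W hB :=
    (denominatorsLin hρ).compat b a b' a' W hC hB hba hba'
  change pull (act G M) (tensorCoeff i a b) W ha * res (ρ.Φ i i') W hA *
      res (denominatorsΦ hρ a a') W hB =
    res (numeratorsΦ hρ b b') W hC * pull (proj G M) (tensorCoeff i' a' b') W hp
  rw [tensorCoeff, tensorCoeff, numeratorsΦ, pull_mul, pull_mul, res_mul, pull_res, pull_res,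
    pull_res, pull_res, res_res]
  linear_combination (-pull (act G M) (ratio b a) W hba * res (denominatorsΦ hρ a a') W hB) * h1 -
    res (ρ.Φ b.i b'.i) W hbb * pull (proj G M) (L.g b'.i i') W hbi' * h2

end Group

end LocalFraction

/-! ### Absolute invariants as sections of the trivial bundle -/

section Trivial

variable (X : Scheme.{0}) [IsIntegral X]

/-- The trivial line bundle. -/
def trivialBundle : LineBundle X where
  idx := Unit
  U _ := ⊤
  nonempty _ := ⟨⟨Nonempty.some inferInstance, trivial⟩⟩
  cover := iSup_const
  g _ _ := 1
  g_self _ := rfl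
  g_mul _ _ _ W _ _ _ := by simp [res]

variable {X}

/-- A rational function as a section of the trivial line bundle. -/
def trivialSection (I : X.functionField) : RationalSection (trivialBundle X) where
  val _ := I
  compat _ _ W _ h := by
    have h1 : toRat (res (1 : Γ(X, (⊤ : X.Opens) ⊓ ⊤)) W h) = 1 := by simp [res, toRat]
    exact (by rw [h1, _root_.one_mul] :
      I = toRat (res (1 : Γ(X, (⊤ : X.Opens) ⊓ ⊤)) W h) * I)

variable {G M : CScheme} [GrpObj G] [ModObj G M] [IsIntegral M.left]

variable (G M) in
/-- The trivial action on the fibres of the trivial line bundle. -/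
def trivialLin : Linearization G M (trivialBundle M.left) where
  Φ _ _ := 1
  compat _ _ _ _ _ _ _ _ _ := (congrArg₂ (· * ·) (map_one _) (map_one _)).trans
    (congrArg₂ (· * ·) (map_one _) (map_one _)).symm
  one _ _ _ _ _ := (map_one _).trans (map_one _).symm
  mul _ _ _ _ _ _ _ := (map_one _).trans
    ((congrArg₂ (· * ·) (map_one _) (map_one _)).trans (_root_.mul_one _)).symm

/-- Absolute invariance concerns one representative of I, invariance of a section two of them, on V
and V'. They glue to a single function on V ∪ V'. -/
theorem trivialSection_isInvariant {I : M.left.functionField} (hI : IsAbsoluteInvariant G M I) :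
    (trivialSection I).IsInvariant (trivialLin G M) := by
  intro i j V V' _ _ f f' (hf : toRat f = I) (hf' : toRat f' = I) W ha hp h
  have hVV : Nonempty (V ⊔ V' : M.left.Opens) :=
    let ⟨x⟩ := (inferInstance : Nonempty V)
    ⟨⟨x.1, Or.inl x.2⟩⟩
  obtain ⟨r, hr⟩ : ∃ r : Γ(M.left, V ⊔ V'), toRat r = I := by
    have hne : ∀ c : Bool, Nonempty ((if c then V else V' : M.left.Opens)) := by
      rintro (_ | _) <;> assumption
    let t (c : Bool) : Γ(M.left, if c then V else V') := match c with
      | true => f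
      | false => f'
    have ht (c : Bool) : toRat (t c) = I := by
      cases c
      · exact hf'
      · exact hf
    obtain ⟨r, hr⟩ := exists_gluing (fun c : Bool ↦ if c then V else V') (U := V ⊔ V')
      (by rintro (_ | _); exacts [le_sup_right, le_sup_left])
      (sup_le (le_iSup (fun c : Bool ↦ if c then V else V') true)
        (le_iSup (fun c : Bool ↦ if c then V else V') false)) t
      (fun c d ↦ ext_toRat fun {_} ↦ by rw [toRat_res, toRat_res, ht, ht])
    refine ⟨r, ?_⟩
    rw [← hf, ← toRat_res r le_sup_left]
    exact congrArg toRat (hr true)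
  have h1 := hI (V ⊔ V') r hr W (ha.trans ((act G M).preimage_mono le_sup_left))
    (hp.trans ((proj G M).preimage_mono le_sup_right))
  rw [pull_eq_of_toRat_eq (act G M) (hf.trans hr.symm) ha
      (ha.trans ((act G M).preimage_mono le_sup_left)), h1,
    pull_eq_of_toRat_eq (proj G M) (hr.trans hf'.symm) _ hp]
  have h2 : res ((trivialLin G M).Φ i j) W h = 1 := map_one _
  rw [h2, _root_.one_mul]

variable (G M) in
/-- The trivial action on the trivial line bundle. -/
def trivialLie : LieLinearization G M (trivialBundle M.left) where
  lam _ := 0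
  regular _ _ := ⟨0, map_zero _⟩
  cocycle _ X Y := by simp
  compat _ _ X W _ h := by
    have h1 : toRat (res ((trivialBundle M.left).g () ()) W h) = 1 := 
      (congrArg toRat (map_one _)).trans toRat_one
    change (0 : M.left.functionField) - 0 = X.1 (toRat (res ((trivialBundle M.left).g () ()) W h)) /
      toRat (res ((trivialBundle M.left).g () ()) W h)
    rw [h1, Derivation.map_one_eq_zero]
    simp

theorem trivialSection_isLieInvariant {I : M.left.functionField}
    (hI : IsLieAbsoluteInvariant G M I) : (trivialSection I).IsLieInvariant (trivialLie G M) :=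
  fun _ X ↦ (hI X).trans (zero_mul I).symm

end Trivial

end

/-! ### The four statements -/

section Invariants

variable {G M : CScheme} [GrpObj G] [ModObj G M] [IsIntegral M.left] [Smooth M.hom]

/-- For the trivial bundle I q is regular and lives in the same bundle as q, so P is the canonical
section of the denominators scaled by I. This also covers I = 0, where there is no divisor of
numerators. -/
theorem IsAbsoluteInvariant.exists_eq_div [Flat G.hom] {I : M.left.functionField}
    (hI : IsAbsoluteInvariant G M I) :
    ∃ (L : LineBundle M.left) (ρ : Linearization G M L) (P Q : RationalSection L),
      P.IsRegular ∧ Q.IsRegular ∧ P.IsInvariant ρ ∧ Q.IsInvariant ρ ∧ Q.IsNonzero ∧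
      ∀ i, I = P.val i / Q.val i := by
  let R := trivialSection I
  have hρ : R.IsInvariant (trivialLin G M) := trivialSection_isInvariant hI
  let D := LocalFraction.denominators R
  have hp (a : LocalFraction R) : toRat a.p = I * toRat a.q := a.toRat_p
  refine ⟨D.lineBundle, LocalFraction.denominatorsLin hρ, D.scaledSection I, D.canonicalSection,
    fun (a : LocalFraction R) ↦ ⟨a.p, hp a⟩, D.canonicalSection_isRegular,
    D.isInvariant _ _ _ LocalFraction.p hp fun a b ↦ ?_,
    D.isInvariant _ _ _ LocalFraction.q (fun _ ↦ rfl) (LocalFraction.pull_act_q hρ),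
    D.canonicalSection_isNonzero,
    fun (a : LocalFraction R) ↦ (mul_div_cancel_right₀ I a.chart.q_ne_zero).symm⟩
  -- The trivial linearization has Φ = 1, so numerators and denominators transform alike.
  have h : LocalFraction.numeratorsΦ hρ a b = LocalFraction.denominatorsΦ hρ a b :=
    (congrArg (· * _) (map_one _)).trans (_root_.one_mul _)
  rw [← h]
  exact LocalFraction.pull_act_p hρ a b

theorem RationalSection.IsInvariant.exists_eq_div [Flat G.hom] {L : LineBundle M.left}
    {ρ : Linearization G M L} {R : RationalSection L} (hR : R.IsNonzero) (hρ : R.IsInvariant ρ) :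
    ∃ (LP : LineBundle M.left) (ρP : Linearization G M LP) (P : RationalSection LP)
      (LQ : LineBundle M.left) (ρQ : Linearization G M LQ) (Q : RationalSection LQ)
      (e : TensorIso L LQ LP),
      P.IsRegular ∧ P.IsInvariant ρP ∧ P.IsNonzero ∧ Q.IsRegular ∧ Q.IsInvariant ρQ ∧
      Q.IsNonzero ∧ e.IsEquivariant ρ ρQ ρP ∧ e.MapsTo R Q P :=
  ⟨_, LocalFraction.numeratorsLin hρ hR, (LocalFraction.numerators hR).canonicalSection,
    _, LocalFraction.denominatorsLin hρ, (LocalFraction.denominators R).canonicalSection,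
    LocalFraction.tensorIso hR, LocalEquations.canonicalSection_isRegular _,
    LocalEquations.isInvariant _ _ _ _ LocalFraction.p (fun _ ↦ rfl) (LocalFraction.pull_act_p hρ),
    LocalEquations.canonicalSection_isNonzero _, LocalEquations.canonicalSection_isRegular _,
    LocalEquations.isInvariant _ _ _ _ LocalFraction.q (fun _ ↦ rfl) (LocalFraction.pull_act_q hρ),
    LocalEquations.canonicalSection_isNonzero _, LocalFraction.tensorIso_isEquivariant hρ hR,
    LocalFraction.tensorIso_mapsTo hR⟩

theorem IsLieAbsoluteInvariant.exists_eq_div {I : M.left.functionField}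
    (hI : IsLieAbsoluteInvariant G M I) :
    ∃ (L : LineBundle M.left) (ρ : LieLinearization G M L) (P Q : RationalSection L),
      P.IsRegular ∧ Q.IsRegular ∧ P.IsLieInvariant ρ ∧ Q.IsLieInvariant ρ ∧ Q.IsNonzero ∧
      ∀ i, I = P.val i / Q.val i := by
  let R := trivialSection I
  have hρ : R.IsLieInvariant (trivialLie G M) := trivialSection_isLieInvariant hI
  let D := LocalFraction.denominators R
  refine ⟨D.lineBundle, LocalFraction.denominatorsLie hρ, D.scaledSection I, D.canonicalSection,
    fun (a : LocalFraction R) ↦ ⟨a.p, a.toRat_p⟩, D.canonicalSection_isRegular,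
    fun (a : LocalFraction R) X ↦ ?_, D.canonicalSection_isLieInvariant _,
    D.canonicalSection_isNonzero,
    fun (a : LocalFraction R) ↦ (mul_div_cancel_right₀ I a.chart.q_ne_zero).symm⟩
  have hq := a.chart.q_ne_zero
  change X.1 (I * toRat a.q) = X.1 (toRat a.q) / toRat a.q * (I * toRat a.q)
  rw [Derivation.leibniz, hI X]
  simp only [smul_eq_mul]
  field_simp
  ring

theorem RationalSection.IsLieInvariant.exists_eq_div {L : LineBundle M.left}
    {ρ : LieLinearization G M L} {R : RationalSection L} (hR : R.IsNonzero)
    (hρ : R.IsLieInvariant ρ) :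
    ∃ (LP : LineBundle M.left) (ρP : LieLinearization G M LP) (P : RationalSection LP)
      (LQ : LineBundle M.left) (ρQ : LieLinearization G M LQ) (Q : RationalSection LQ)
      (e : TensorIso L LQ LP),
      P.IsRegular ∧ P.IsLieInvariant ρP ∧ P.IsNonzero ∧ Q.IsRegular ∧ Q.IsLieInvariant ρQ ∧
      Q.IsNonzero ∧ e.IsLieEquivariant ρ ρQ ρP ∧ e.MapsTo R Q P :=
  ⟨_, LocalFraction.numeratorsLie hρ hR, (LocalFraction.numerators hR).canonicalSection,
    _, LocalFraction.denominatorsLie hρ, (LocalFraction.denominators R).canonicalSection,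
    LocalFraction.tensorIso hR, LocalEquations.canonicalSection_isRegular _,
    LocalEquations.canonicalSection_isLieInvariant _ _,
    LocalEquations.canonicalSection_isNonzero _, LocalEquations.canonicalSection_isRegular _,
    LocalEquations.canonicalSection_isLieInvariant _ _,
    LocalEquations.canonicalSection_isNonzero _, LocalFraction.tensorIso_isLieEquivariant hρ hR,
    LocalFraction.tensorIso_mapsTo hR⟩

end Invariants

end RelInv

theorem mainTheorem11 (G M : RelInv.CScheme)
    [GrpObj G] [Smooth G.hom] [IsSeparated G.hom] [QuasiCompact G.hom]
    [IsIntegral M.left] [Smooth M.hom] [IsSeparated M.hom] [QuasiCompact M.hom]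
    [ModObj G M] :
    -- rational absolute `G`-invariants
    (∀ I : M.left.functionField, RelInv.IsAbsoluteInvariant G M I →
      ∃ (L : RelInv.LineBundle M.left) (ρ : RelInv.Linearization G M L)
        (P Q : RelInv.RationalSection L),
        P.IsRegular ∧ Q.IsRegular ∧ P.IsInvariant ρ ∧ Q.IsInvariant ρ ∧ Q.IsNonzero ∧
        ∀ i, I = P.val i / Q.val i) ∧
    -- rational relative `G`-invariants
    (∀ (L : RelInv.LineBundle M.left) (ρ : RelInv.Linearization G M L)
      (R : RelInv.RationalSection L), R.IsNonzero → R.IsInvariant ρ →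
      ∃ (LP : RelInv.LineBundle M.left) (ρP : RelInv.Linearization G M LP)
        (P : RelInv.RationalSection LP)
        (LQ : RelInv.LineBundle M.left) (ρQ : RelInv.Linearization G M LQ)
        (Q : RelInv.RationalSection LQ) (e : RelInv.TensorIso L LQ LP),
        P.IsRegular ∧ P.IsInvariant ρP ∧ P.IsNonzero ∧
        Q.IsRegular ∧ Q.IsInvariant ρQ ∧ Q.IsNonzero ∧
        e.IsEquivariant ρ ρQ ρP ∧ e.MapsTo R Q P) ∧
    -- rational absolute invariants of the Lie algebra of vector fields
    (∀ I : M.left.functionField, RelInv.IsLieAbsoluteInvariant G M I →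
      ∃ (L : RelInv.LineBundle M.left) (ρ : RelInv.LieLinearization G M L)
        (P Q : RelInv.RationalSection L),
        P.IsRegular ∧ Q.IsRegular ∧ P.IsLieInvariant ρ ∧ Q.IsLieInvariant ρ ∧ Q.IsNonzero ∧
        ∀ i, I = P.val i / Q.val i) ∧
    -- rational relative invariants of the Lie algebra of vector fields
    (∀ (L : RelInv.LineBundle M.left) (ρ : RelInv.LieLinearization G M L)
      (R : RelInv.RationalSection L), R.IsNonzero → R.IsLieInvariant ρ →
      ∃ (LP : RelInv.LineBundle M.left) (ρP : RelInv.LieLinearization G M LP)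
        (P : RelInv.RationalSection LP)
        (LQ : RelInv.LineBundle M.left) (ρQ : RelInv.LieLinearization G M LQ)
        (Q : RelInv.RationalSection LQ) (e : RelInv.TensorIso L LQ LP),
        P.IsRegular ∧ P.IsLieInvariant ρP ∧ P.IsNonzero ∧
        Q.IsRegular ∧ Q.IsLieInvariant ρQ ∧ Q.IsNonzero ∧
        e.IsLieEquivariant ρ ρQ ρP ∧ e.MapsTo R Q P) :=
  ⟨fun _ hI ↦ hI.exists_eq_div, fun _ _ _ hR hρ ↦ hρ.exists_eq_div hR,
    fun _ hI ↦ hI.exists_eq_div, fun _ _ _ hR hρ ↦ hρ.exists_eq_div hR⟩
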